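/- **Theorem 1.1.** Let $p\in[2,\infty)$ and let $p'=p/(p-1)$. Let $n\ge 1$, let $\sigma,\omega$ be locally finite non-negative Borel measures on $\mathbb R^n$, and let $\eta=\sum_{k\in\mathbb Z}\delta_{2^k}$ on $(0,\infty)$. Let $\mathscr D=\{2^{-k}([0,1)^n+m): k\in\mathbb Z,\ m\in\mathbb Z^n\}$ be the dyadic cubes, and for $Q\in\mathscr D$ with side length $\ell(Q)$ let $\widehat Q=Q\times(0,\ell(Q)]$. For a $\sigma\times\eta$-measurable function $f$ on $\mathbb R^n\times(0,\infty)$ put $$|f|_{\ell^2}(x)=\Big(\sum_{k\in\mathbb Z}|f(x,2^{-k})|^2\Big)^{1/2},\qquad \|f\|_{L^r(\sigma;\ell^2)}=\Big(\int_{\mathbb R^n}|f|_{\ell^2}^r\,d\sigma\Big)^{1/r}\quad(1\le r<\infty),$$ and let $L^r(\sigma;\ell^2)$ be the space of those $f$ for which this norm is finite. Let $\mu\colon\mathbb R^n\times(0,\infty)\to[0,\infty)$ be $\sigma\times\eta$-measurable with $\|1_{\widehat Q}\mu\|_{L^{p'}(\sigma;\ell^2)}<\infty$ for every $Q\in\mathscr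 D$, and let $\lambda_Q\in[0,\infty)$ for each $Q\in\mathscr D$. For $\sigma\times\eta$-measurable $f\ge0$, Borel $g\ge 0$ and $Q_0\in\mathscr D$ let $$\Lambda(f,g)=\sum_{Q\in\mathscr D}\lambda_Q\iint_{\widehat Q}f\mu\,d\eta\,d\sigma\int_Q g\,d\omega,\qquad \Lambda_{Q_0}(f,g)=\sum_{Q\in\mathscr D,\ Q\subseteq Q_0}\lambda_Q\iint_{\widehat Q}f\mu\,d\eta\,d\sigma\int_Q g\,d\omega,$$ and let $\varphi_Q=|1_{\widehat Q}\mu|_{\ell^2}^{p'-2}\,1_{\widehat Q}\mu$, understood as $0$ where $|1_{\widehat Q}\mu|_{\ell^2}=0$. Let $\mathcal T,\mathcal T^*\in[0,\infty]$ be the smallest constants such that $$\Lambda_Q(\varphi_Q,g)\le\mathcal T\,\|\varphi_Q\|_{L^p(\sigma;\ell^2)}\|g\|_{L^{p'}(\omega)},\qquad \Lambda_Q(f,1_Q)\le\mathcal T^*\,\|f\|_{L^p(\sigma;\ell^2)}\|1_Q\|_{L^{p'}(\omega)}$$ hold for all $Q\in\mathscr D$, all $\sigma\times\eta$-measurable $f\ge0$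 and all Borel $g\ge0$. Then there is a finite constant $C$ such that $$\Lambda(f,g)\le C\,\|f\|_{L^p(\sigma;\ell^2)}\|g\|_{L^{p'}(\omega)}\quad\text{for all } \sigma\times\eta\text{-measurable } f\ge0\text{ and Borel } g\ge0\qquad(1)$$ if and only if $\mathcal T+\mathcal T^*<\infty$. Property (1) for some finite $C$ is also equivalent to the boundedness of the operator $T^\sigma f=\sum_{Q\in\mathscr D}\lambda_Q\big(\iint_{\widehat Q}f\mu\,d\eta\,d\sigma\big)1_Q$ from $L^p(\sigma;\ell^2)$ to $L^p(\omega)$, where the series is required to converge absolutely $\omega$-almost everywhere. Moreover, if $\mathcal T+\mathcal T^*<\infty$, then the smallest possible constant $\|\Lambda\|$ in (1) satisfies $c_p^{-1}(\mathcal T+\mathcal T^*)\le\|\Lambda\|\le c_p(\mathcal T+\mathcal T^*)$ with a constant $c_p$ that depends only on $p$. -/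

import Mathlib

open MeasureTheory
open scoped ENNReal NNReal

noncomputable section

namespace MixedDyadic

/-- The open upper half-space `ℝⁿ × (0, ∞)`. -/
abbrev HalfSpace (n : ℕ) : Type := (Fin n → ℝ) × Set.Ioi (0 : ℝ)

/-- The point `2 ^ k` of `(0, ∞)`. -/
def twoPow (k : ℤ) : Set.Ioi (0 : ℝ) := ⟨(2 : ℝ) ^ k, Set.mem_Ioi.2 (zpow_pos two_pos k)⟩

/-- The measure `η = ∑ₖ δ_{2 ^ k}` on `(0, ∞)`. -/
def eta : Measure (Set.Ioi (0 : ℝ)) := Measure.sum fun k : ℤ => Measure.dirac (twoPow k)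

/-- The dyadic cubes `2 ^ (-k) ([0,1)ⁿ + m)`. For `n ≥ 1` the set `Q.toSet` determines the pair
`(k, m)`, so that indexing by the pairs is the same as indexing by the sets. -/
@[ext] structure DyadicCube (n : ℕ) where
  /-- the generation -/
  k : ℤ
  /-- the position -/
  m : Fin n → ℤ

namespace DyadicCube

variable {n : ℕ}

/-- The side length `ℓ(Q)`. -/
def side (Q : DyadicCube n) : ℝ := (2 : ℝ) ^ (-Q.k)

/-- The half-open cube as a subset of `ℝⁿ`. -/
def toSet (Q : DyadicCube n) : Set (Fin n → ℝ) :=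
  {x | ∀ i, Q.side * (Q.m i : ℝ) ≤ x i ∧ x i < Q.side * ((Q.m i : ℝ) + 1)}

/-- The Carleson box `Q × (0, ℓ(Q)]`. -/
def box (Q : DyadicCube n) : Set (HalfSpace n) :=
  {z | z.1 ∈ Q.toSet ∧ (z.2 : ℝ) ≤ Q.side}

end DyadicCube

/-- `|f|_{ℓ²}(x) = (∑ₖ |f(x, 2 ^ (-k))|²) ^ (1/2)`, with values in `[0, ∞]`. -/
def ell2Norm {n : ℕ} {E : Type*} [ENorm E] (f : HalfSpace n → E) (x : Fin n → ℝ) : ℝ≥0∞ :=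
  (∑' k : ℤ, ‖f (x, twoPow (-k))‖ₑ ^ 2) ^ (1 / 2 : ℝ)

/-- The mixed norm `‖f‖_{L^p(σ; ℓ²)}`, with values in `[0, ∞]`. -/
def mixedNorm {n : ℕ} {E : Type*} [ENorm E] (p : ℝ) (σ : Measure (Fin n → ℝ))
    (f : HalfSpace n → E) : ℝ≥0∞ :=
  eLpNorm (ell2Norm f) (ENNReal.ofReal p) σ

section Form

variable {n : ℕ} (σ ω : Measure (Fin n → ℝ)) (μ : HalfSpace n → ℝ≥0) (lam : DyadicCube n → ℝ≥0)

/-- The summand `λ_Q ∬_{Q̂} f μ dη dσ ∫_Q g dω`. -/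
def formTerm (f : HalfSpace n → ℝ≥0) (g : (Fin n → ℝ) → ℝ≥0) (Q : DyadicCube n) : ℝ≥0∞ :=
  (lam Q : ℝ≥0∞) * (∫⁻ z in Q.box, (f z : ℝ≥0∞) * (μ z : ℝ≥0∞) ∂(σ.prod eta)) *
    ∫⁻ x in Q.toSet, (g x : ℝ≥0∞) ∂ω

/-- The bilinear form `Λ(f, g)`. -/
def form (f : HalfSpace n → ℝ≥0) (g : (Fin n → ℝ) → ℝ≥0) : ℝ≥0∞ :=
  ∑' Q : DyadicCube n, formTerm σ ω μ lam f g Q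

/-- The localized form `Λ_{Q₀}(f, g)`: the sum over the dyadic cubes `Q ⊆ Q₀`. -/
def localForm (Q₀ : DyadicCube n) (f : HalfSpace n → ℝ≥0) (g : (Fin n → ℝ) → ℝ≥0) : ℝ≥0∞ :=
  ∑' Q : {Q : DyadicCube n // Q.toSet ⊆ Q₀.toSet}, formTerm σ ω μ lam f g Q.1

/-- The test function `φ_Q = |1_{Q̂} μ|_{ℓ²} ^ (p' - 2) 1_{Q̂} μ`. Where `|1_{Q̂} μ|_{ℓ²} = 0` and
`p' < 2` the first factor is `(⊤ : ℝ≥0∞).toNNReal = 0`, so that `φ_Q = 0` there. -/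
def testFun (p' : ℝ) (Q : DyadicCube n) (z : HalfSpace n) : ℝ≥0 :=
  (ell2Norm (Q.box.indicator μ) z.1 ^ (p' - 2)).toNNReal * Q.box.indicator μ z

/-- `Λ(f, g) ≤ C ‖f‖_{L^p(σ; ℓ²)} ‖g‖_{L^{p'}(ω)}` for all non-negative `f` and `g`. -/
def FormBound (p p' : ℝ) (C : ℝ≥0∞) : Prop :=
  ∀ f : HalfSpace n → ℝ≥0, AEMeasurable f (σ.prod eta) →
    ∀ g : (Fin n → ℝ) → ℝ≥0, Measurable g →
      form σ ω μ lam f g ≤ C * mixedNorm p σ f * eLpNorm g (ENNReal.ofReal p') ω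

/-- The direct testing condition, with `φ_Q` in the first slot. -/
def TestingBound (p p' : ℝ) (C : ℝ≥0∞) : Prop :=
  ∀ Q : DyadicCube n, ∀ g : (Fin n → ℝ) → ℝ≥0, Measurable g →
    localForm σ ω μ lam Q (testFun μ p' Q) g ≤
      C * mixedNorm p σ (testFun μ p' Q) * eLpNorm g (ENNReal.ofReal p') ω

/-- The dual testing condition, with `1_Q` in the second slot. -/
def DualTestingBound (p p' : ℝ) (C : ℝ≥0∞) : Prop :=
  ∀ Q : DyadicCube n, ∀ f : HalfSpace n → ℝ≥0, AEMeasurable f (σ.prod eta) →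
    localForm σ ω μ lam Q f (Q.toSet.indicator 1) ≤
      C * mixedNorm p σ f *
        eLpNorm (Q.toSet.indicator (1 : (Fin n → ℝ) → ℝ≥0)) (ENNReal.ofReal p') ω

/-- `‖Λ‖`: the smallest constant in `FormBound`, possibly `∞`. -/
def formNorm (p p' : ℝ) : ℝ≥0∞ := sInf {C | FormBound σ ω μ lam p p' C}

/-- `𝒯`: the smallest constant in `TestingBound`, possibly `∞`. -/
def testingConst (p p' : ℝ) : ℝ≥0∞ := sInf {C | TestingBound σ ω μ lam p p' C}

/-- `𝒯*`: the smallest constant in `DualTestingBound`, possibly `∞`. -/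
def dualTestingConst (p p' : ℝ) : ℝ≥0∞ := sInf {C | DualTestingBound σ ω μ lam p p' C}

/-- The summand `λ_Q (∬_{Q̂} f μ dη dσ) 1_Q(x)` of `T^σ f (x)`. -/
def opTerm (f : HalfSpace n → ℂ) (x : Fin n → ℝ) (Q : DyadicCube n) : ℂ :=
  Q.toSet.indicator
    (fun _ => ((lam Q : ℝ) : ℂ) * ∫ z in Q.box, f z * ((μ z : ℝ) : ℂ) ∂(σ.prod eta)) x

/-- The operator `T^σ f = ∑_Q λ_Q (∬_{Q̂} f μ dη dσ) 1_Q`. -/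
def op (f : HalfSpace n → ℂ) (x : Fin n → ℝ) : ℂ :=
  ∑' Q : DyadicCube n, opTerm σ μ lam f x Q

/-- `T^σ` is a bounded operator from `L^p(σ; ℓ²)` to `L^p(ω)`: for every (complex-valued)
`f ∈ L^p(σ; ℓ²)` the integrals in the definition of `T^σ f` exist, the series converges absolutely
`ω`-almost everywhere, and `‖T^σ f‖_{L^p(ω)} ≤ C ‖f‖_{L^p(σ; ℓ²)}`. -/
def OpBounded (p : ℝ) : Prop :=
  ∃ C : ℝ≥0, ∀ f : HalfSpace n → ℂ, AEMeasurable f (σ.prod eta) → mixedNorm p σ f < ∞ →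
    (∀ Q : DyadicCube n, IntegrableOn (fun z => f z * ((μ z : ℝ) : ℂ)) Q.box (σ.prod eta)) ∧
    (∀ᵐ x ∂ω, Summable (opTerm σ μ lam f x)) ∧
    eLpNorm (op σ μ lam f) (ENNReal.ofReal p) ω ≤ C * mixedNorm p σ f

end Form

end MixedDyadic

end

open MixedDyadic

/-!
The bound for the form implies the two testing conditions because the localised forms are dominated
by `Λ`, and it is equivalent to the bound for the operator by duality (`FormBound.opBounded`,
`OpBounded.exists_formBound`). The content is the converse, that the testing conditions bound `Λ`.

Write `A_Q = ∬_{Q̂} f μ`, `G_Q = ∫_Q g dω`, `a_Q = |1_{Q̂} μ|_{ℓ²}` and `M_Q = ∫ a_Q ^ p' dσ`. The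
test function `φ_Q` extremises `f ↦ A_Q`: both `∬_{Q̂} φ_Q μ` and `‖φ_Q‖ ^ p` are equal to `M_Q`. For
normalised `f` and `g`, the cubes are split according to which of `(G_Q / ω(Q)) ^ p' ω(Q)` and
`(A_Q / M_Q) ^ p M_Q` is larger (`form_le_of_norm_le_one`).

If the term with `A_Q` is larger, take principal cubes for `f`: below a principal cube `R`, the next
ones are the maximal cubes `Q` on which `A_Q` exceeds `2 (A_R / M_R) ν_R(Q)`, with
`ν_R(Q) = ∬_{Q̂} φ_R μ`. Between principal cubes, `A_Q` is dominated by the quantity which the direct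
testing condition for `φ_R` controls, with `g` restricted off the next principal cubes or averaged
over them. The averages are absorbed by the comparison of the two terms, and the sum closes by
Hölder's inequality (`stopping_sum_le`) and a Carleson embedding `∑ (A_R / M_R) ^ p M_R ≲ ‖f‖ ^ p`
over the principal cubes. If the term with `G_Q` is larger, the argument is the same with the roles
exchanged: `f` is restricted off the next principal boxes, and replaced by multiples of the test
functions on them.

The assumption `2 ≤ p` enters three times. As `p' ≤ 2`, Hölder's inequality turns the decay of
`ν_R` into decay of `M` (`sum_boxMass_le`), and the power `p' / 2` is subadditive, which bounds
`‖∑ b_R 1_{R̂} μ‖` by ancestor sums of the coefficients (`mixedNorm_sum_indicator_le`); on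
the other side, the power `p / 2` is superadditive, so that the restrictions of `f` to disjoint
regions have summable `p`-th powers of norms. Both Carleson embeddings follow by duality from the
boundedness of ancestor sums in a forest with geometrically decaying weights
(`sum_ancestorSum_rpow_le`).
-/

namespace MixedDyadic

/-! ### Geometry of the dyadic cubes -/

namespace DyadicCube

variable {n : ℕ}

theorem side_pos (Q : DyadicCube n) : 0 < Q.side := zpow_pos two_pos _

theorem mem_toSet_iff {Q : DyadicCube n} {x : Fin n → ℝ} :
    x ∈ Q.toSet ↔ ∀ i, ⌊(2 : ℝ) ^ Q.k * x i⌋ = Q.m i := by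
  refine forall_congr' fun i => ?_
  have h : (0 : ℝ) < 2 ^ Q.k := zpow_pos two_pos _
  rw [Int.floor_eq_iff, side, zpow_neg, inv_mul_le_iff₀ h, lt_inv_mul_iff₀ h]

theorem toSet_nonempty (Q : DyadicCube n) : Q.toSet.Nonempty := by
  refine ⟨fun i => Q.side * Q.m i, fun i => ⟨le_rfl, ?_⟩⟩
  have := Q.side_pos
  nlinarith

/-- Dyadic cubes are ordered by inclusion. The comparison of the generations follows from the
inclusion of the sets when `0 < n`; requiring it makes this a partial order for every `n`, and
makes the Carleson boxes monotone. -/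
instance : PartialOrder (DyadicCube n) where
  le Q R := R.k ≤ Q.k ∧ Q.toSet ⊆ R.toSet
  le_refl Q := ⟨le_rfl, subset_rfl⟩
  le_trans Q R T h h' := ⟨h'.1.trans h.1, h.2.trans h'.2⟩
  le_antisymm Q R h h' := by
    have hk : Q.k = R.k := le_antisymm h'.1 h.1
    obtain ⟨x, hx⟩ := Q.toSet_nonempty
    have hx' := mem_toSet_iff.1 (h.2 hx)
    rw [mem_toSet_iff] at hx
    ext i
    · exact hk
    · rw [← hx i, ← hx' i, hk]

theorem le_of_mem {Q R : DyadicCube n} {x : Fin n → ℝ} (hQ : x ∈ Q.toSet) (hR : x ∈ R.toSet)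
    (hk : R.k ≤ Q.k) : Q ≤ R := by
  refine ⟨hk, fun y hy => ?_⟩
  rw [mem_toSet_iff] at *
  obtain ⟨j, hj⟩ := Int.le.dest hk
  -- the index of the cube of generation `R.k` around a point is determined by that for `Q.k`
  have key (z : ℝ) : ⌊(2 : ℝ) ^ R.k * z⌋ = ⌊(2 : ℝ) ^ Q.k * z⌋ / ((2 ^ j : ℕ) : ℤ) := by
    rw [← Int.floor_div_natCast, ← hj, zpow_add₀ two_ne_zero]
    congr 1
    push_cast
    rw [zpow_natCast]
    field_simp
  intro i
  rw [← hR i, key, key, hy i, hQ i]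

theorem le_or_le_of_mem {Q R : DyadicCube n} {x : Fin n → ℝ} (hQ : x ∈ Q.toSet)
    (hR : x ∈ R.toSet) : Q ≤ R ∨ R ≤ Q :=
  (le_total R.k Q.k).imp (le_of_mem hQ hR) (le_of_mem hR hQ)

/-- The dyadic cubes form a forest: two cubes with a common subcube are nested. -/
theorem le_or_le_of_le {Q R T : DyadicCube n} (hR : Q ≤ R) (hT : Q ≤ T) : R ≤ T ∨ T ≤ R :=
  let ⟨_, hx⟩ := Q.toSet_nonempty
  le_or_le_of_mem (hR.2 hx) (hT.2 hx)

theorem side_le_side {Q R : DyadicCube n} (h : Q ≤ R) : Q.side ≤ R.side :=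
  zpow_le_zpow_right₀ one_le_two (neg_le_neg h.1)

theorem box_subset_box {Q R : DyadicCube n} (h : Q ≤ R) : Q.box ⊆ R.box := fun _ hz =>
  ⟨h.2 hz.1, hz.2.trans (side_le_side h)⟩

instance : Countable (DyadicCube n) :=
  Function.Injective.countable (f := fun Q : DyadicCube n => (Q.k, Q.m)) fun Q R h => by
    ext1
    · exact congrArg Prod.fst h
    · exact congrArg Prod.snd h

theorem measurableSet_toSet (Q : DyadicCube n) : MeasurableSet Q.toSet := by
  have : Q.toSet = Set.pi Set.univ fun i => Set.Ico (Q.side * (Q.m i : ℝ))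
      (Q.side * ((Q.m i : ℝ) + 1)) := by
    ext x
    simp [toSet]
  rw [this]
  exact MeasurableSet.univ_pi fun _ => measurableSet_Ico

theorem measurableSet_box (Q : DyadicCube n) : MeasurableSet Q.box :=
  (measurable_fst Q.measurableSet_toSet).inter
    (measurableSet_le (measurable_subtype_coe.comp measurable_snd) measurable_const)

theorem measure_toSet_lt_top (ω : Measure (Fin n → ℝ)) [IsLocallyFiniteMeasure ω]
    (Q : DyadicCube n) : ω Q.toSet < ∞ := by
  have : Q.toSet ⊆ Set.Icc (fun i => Q.side * (Q.m i : ℝ)) (fun i => Q.side * ((Q.m i : ℝ) + 1)) :=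
    fun x hx => ⟨fun i => (hx i).1, fun i => (hx i).2.le⟩
  exact (measure_mono this).trans_lt isCompact_Icc.measure_lt_top

end DyadicCube

/-! ### Stopping families in a finite forest -/

section Stopping

variable {ι : Type*} [PartialOrder ι]

/-- A finite set `s` contains a stopping family `S`: an element of `s` belongs to `S` if and only
if it is bad relative to the smallest element of `S` strictly above it, if there is one. -/
theorem exists_stopping (bad : ι → ι → Prop) (s : Finset ι) :
    ∃ S ⊆ s, ∀ Q ∈ s, (Q ∈ S ↔ ∀ R ∈ S, Q < R → (∀ R' ∈ S, Q < R' → R ≤ R') → bad R Q) := by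
  classical
  induction h : s.card generalizing s with
  | zero =>
    rw [Finset.card_eq_zero] at h
    exact ⟨∅, by simp, by simp [h]⟩
  | succ N ih =>
    -- adjoin a minimal element of `s` to a stopping family of the remaining set
    obtain ⟨Q₀, hQ₀⟩ := s.exists_minimal (Finset.card_pos.1 (by omega))
    obtain ⟨S, hS, hS'⟩ := ih (s.erase Q₀) (by rw [Finset.card_erase_of_mem hQ₀.1]; omega)
    have hQ₀S : Q₀ ∉ S := fun h => by simpa using hS h
    have hSs : S ⊆ s := hS.trans (Finset.erase_subset _ _)
    have hlt : ∀ Q ∈ s, ¬ Q < Q₀ := fun Q hQ hlt => hQ₀.not_lt hQ hlt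
    by_cases hc : ∀ R ∈ S, Q₀ < R → (∀ R' ∈ S, Q₀ < R' → R ≤ R') → bad R Q₀
    · refine ⟨insert Q₀ S, Finset.insert_subset hQ₀.1 hSs, fun Q hQ => ?_⟩
      by_cases hQQ : Q = Q₀
      · subst hQQ
        simpa using hc
      · rw [Finset.mem_insert, or_iff_right hQQ, hS' Q (Finset.mem_erase.2 ⟨hQQ, hQ⟩)]
        simp [hlt Q hQ]
    · refine ⟨S, hSs, fun Q hQ => ?_⟩
      by_cases hQQ : Q = Q₀
      · subst hQQ
        exact ⟨fun h => absurd h hQ₀S, fun h => absurd h hc⟩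
      · exact hS' Q (Finset.mem_erase.2 ⟨hQQ, hQ⟩)

/-- The children of `R` in `S`: the elements of `S` whose smallest strict ancestor in `S` is
`R`. -/
noncomputable def children (S : Finset ι) (R : ι) : Finset ι :=
  open scoped Classical in S.filter fun F => F < R ∧ ∀ R' ∈ S, F < R' → R ≤ R'

theorem mem_children {S : Finset ι} {R F : ι} :
    F ∈ children S R ↔ F ∈ S ∧ F < R ∧ ∀ R' ∈ S, F < R' → R ≤ R' := by
  simp [children]

theorem children_subset {S : Finset ι} {R : ι} : children S R ⊆ S := fun _ h =>
  (mem_children.1 h).1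

theorem children_eq {S : Finset ι} {R R' F : ι} (hR : R ∈ S) (hR' : R' ∈ S)
    (h : F ∈ children S R) (h' : F ∈ children S R') : R = R' := by
  rw [mem_children] at h h'
  exact le_antisymm (h.2.2 _ hR' h'.2.1) (h'.2.2 _ hR h.2.1)

theorem eq_of_le_of_mem_children {S : Finset ι} {R F F' : ι} (h : F ∈ children S R)
    (h' : F' ∈ children S R) (hle : F ≤ F') : F = F' := by
  rw [mem_children] at h h'
  by_contra hne
  exact (h.2.2 _ h'.1 (lt_of_le_of_ne hle hne)).not_gt h'.2.1

/-- `ι` is a forest: the elements above a given one form a chain. -/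
def IsForest (ι : Type*) [PartialOrder ι] : Prop :=
  ∀ ⦃a b c : ι⦄, a ≤ b → a ≤ c → b ≤ c ∨ c ≤ b

theorem exists_parent (hι : IsForest ι) {S : Finset ι} {F R : ι} (hF : F ∈ S) (hR : R ∈ S)
    (h : F < R) : ∃ R' ∈ S, F ∈ children S R' := by
  classical
  obtain ⟨R', hR'⟩ := (S.filter (F < ·)).exists_minimal ⟨R, by simp [hR, h]⟩
  have h1 := Finset.mem_filter.1 hR'.1
  refine ⟨R', h1.1, mem_children.2 ⟨hF, h1.2, fun T hT hFT => ?_⟩⟩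
  rcases hι h1.2.le hFT.le with h2 | h2
  · exact h2
  · exact hR'.2 (Finset.mem_filter.2 ⟨hT, hFT⟩) h2

theorem exists_child (hι : IsForest ι) {S : Finset ι} {F R : ι} (hF : F ∈ S) (h : F < R) :
    ∃ F' ∈ children S R, F ≤ F' := by
  classical
  obtain ⟨F', hF'⟩ := (S.filter fun T => F ≤ T ∧ T < R).exists_maximal ⟨F, by simp [hF, h]⟩
  have h1 := Finset.mem_filter.1 hF'.1
  refine ⟨F', mem_children.2 ⟨h1.1, h1.2.2, fun T hT hFT => ?_⟩, h1.2.1⟩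
  rcases hι (h1.2.1.trans hFT.le) h.le with h2 | h2
  · rcases h2.eq_or_lt with h3 | h3
    · exact h3.ge
    · exact absurd (hF'.2 (Finset.mem_filter.2 ⟨hT, h1.2.1.trans hFT.le, h3⟩) hFT.le)
        hFT.not_ge
  · exact h2

/-- Every element of `s` lies below a smallest element of the stopping family, and is not bad
relative to it. -/
theorem exists_stopping_parent {bad : ι → ι → Prop} {s S : Finset ι}
    (hS : ∀ Q ∈ s, (Q ∈ S ↔ ∀ R ∈ S, Q < R → (∀ R' ∈ S, Q < R' → R ≤ R') → bad R Q))
    {Q : ι} (hQ : Q ∈ s) :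
    ∃ F ∈ S, Q ≤ F ∧ (∀ F' ∈ S, Q ≤ F' → F ≤ F') ∧ (F = Q ∨ ¬ bad F Q) := by
  by_cases hQS : Q ∈ S
  · exact ⟨Q, hQS, le_rfl, fun _ _ h => h, Or.inl rfl⟩
  · have h := hQS
    rw [hS Q hQ] at h
    push Not at h
    obtain ⟨R, hR, hQR, hmin, hbad⟩ := h
    refine ⟨R, hR, hQR.le, fun F' hF' hle => hmin F' hF' (lt_of_le_of_ne hle ?_), Or.inr hbad⟩
    rintro rfl
    exact hQS hF'

/-- The sum of the coefficients `b` over the ancestors of `F` in `S`. -/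
noncomputable def ancestorSum (S : Finset ι) (b : ι → ℝ≥0∞) (F : ι) : ℝ≥0∞ :=
  open scoped Classical in ∑ R ∈ S.filter (F ≤ ·), b R

/-- On a chain, the total sum of coefficients is one of the ancestor sums. -/
theorem sum_rpow_le_sum_ancestorSum_rpow {S T : Finset ι} (hTS : T ⊆ S)
    (hT : ∀ a ∈ T, ∀ b ∈ T, a ≤ b ∨ b ≤ a) (b : ι → ℝ≥0∞) {s : ℝ} (hs : 0 < s) :
    (∑ R ∈ T, b R) ^ s ≤ ∑ F ∈ T, ancestorSum S b F ^ s := by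
  classical
  rcases T.eq_empty_or_nonempty with rfl | hne
  · simp [hs]
  · obtain ⟨F, hF⟩ := T.exists_minimal hne
    have h1 : ∑ R ∈ T, b R ≤ ancestorSum S b F := by
      refine Finset.sum_le_sum_of_subset fun R hR => Finset.mem_filter.2 ⟨hTS hR, ?_⟩
      exact (hT F hF.1 R hR).elim id fun h => hF.2 hR h
    refine (ENNReal.rpow_le_rpow h1 hs.le).trans ?_
    exact Finset.single_le_sum (f := fun F => ancestorSum S b F ^ s) (fun _ _ => zero_le) hF.1

/-- The constant in the embedding `sum_ancestorSum_rpow_le`. -/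
noncomputable def treeConst (θ : ℝ≥0∞) (s : ℝ) : ℝ≥0∞ := ((1 - θ ^ (1 / s))⁻¹) ^ s

theorem treeConst_lt_top {θ : ℝ≥0∞} (hθ : θ < 1) {s : ℝ} (hs : 0 < s) : treeConst θ s < ∞ := by
  refine ENNReal.rpow_lt_top_of_nonneg hs.le ?_
  rw [ENNReal.inv_ne_top]
  exact (tsub_pos_of_lt (ENNReal.rpow_lt_one hθ (by positivity))).ne'

/-- If the weights of the children of `R` add up to at most `θ < 1` times the weight of `R`, then
passing to ancestor sums is bounded on the weighted space `ℓ^s`: the sums over strict ancestors are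
the ancestor sums at the parents, so that their norm is smaller by the factor `θ ^ (1 / s)`. -/
theorem sum_ancestorSum_rpow_le (hι : IsForest ι) {S : Finset ι} {m b : ι → ℝ≥0∞}
    (hm : ∀ F ∈ S, m F ≠ ∞) (hb : ∀ F ∈ S, b F ≠ ∞) {θ : ℝ≥0∞} (hθ : θ < 1)
    (hch : ∀ R ∈ S, ∑ F ∈ children S R, m F ≤ θ * m R) {s : ℝ} (hs : 1 ≤ s) :
    ∑ F ∈ S, ancestorSum S b F ^ s * m F ≤ treeConst θ s * ∑ F ∈ S, b F ^ s * m F := by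
  classical
  have hs0 : 0 < s := by linarith
  set B := ancestorSum S b with hB
  let B' : ι → ℝ≥0∞ := fun F => ∑ R ∈ S.filter (F < ·), b R
  have hBB' : ∀ F ∈ S, B F = b F + B' F := by
    intro F hF
    have : S.filter (F ≤ ·) = insert F (S.filter (F < ·)) := by
      ext R
      simp only [Finset.mem_filter, Finset.mem_insert, le_iff_lt_or_eq]
      constructor
      · rintro ⟨h, h' | h'⟩ <;> simp_all
      · rintro (rfl | h) <;> simp_all
    simp only [hB, ancestorSum, B', this]
    rw [Finset.sum_insert (by simp)]
  have hB'm : ∑ F ∈ S, B' F ^ s * m F ≤ θ * ∑ R ∈ S, B R ^ s * m R := by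
    calc ∑ F ∈ S, B' F ^ s * m F
        ≤ ∑ F ∈ S, ∑ R ∈ S, if F ∈ children S R then B R ^ s * m F else 0 := by
          refine Finset.sum_le_sum fun F hF => ?_
          by_cases hp : ∃ R ∈ S, F < R
          · obtain ⟨R, hR, hFR⟩ := hp
            obtain ⟨P, hP, hFP⟩ := exists_parent hι hF hR hFR
            have : B' F ≤ B P := by
              refine Finset.sum_le_sum_of_subset fun T hT => ?_
              rw [Finset.mem_filter] at hT ⊢
              exact ⟨hT.1, (mem_children.1 hFP).2.2 T hT.1 hT.2⟩
            refine le_trans ?_ (Finset.single_le_sum (fun _ _ => zero_le) hP)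
            rw [if_pos hFP]
            gcongr
          · have : S.filter (F < ·) = ∅ := by
              rw [Finset.filter_eq_empty_iff]
              exact fun R hR h => hp ⟨R, hR, h⟩
            simp [B', this, hs0]
      _ = ∑ R ∈ S, B R ^ s * ∑ F ∈ children S R, m F := by
          rw [Finset.sum_comm]
          refine Finset.sum_congr rfl fun R _ => ?_
          rw [← Finset.sum_filter, Finset.mul_sum,
            Finset.filter_mem_eq_inter, Finset.inter_eq_right.2 children_subset]
      _ ≤ ∑ R ∈ S, B R ^ s * (θ * m R) := by
          gcongr with R hR
          exact hch R hR
      _ = _ := by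
          rw [Finset.mul_sum]
          exact Finset.sum_congr rfl fun _ _ => by ring
  have hmink := ENNReal.Lp_add_le S (fun F => b F * m F ^ (1 / s))
    (fun F => B' F * m F ^ (1 / s)) hs
  have hpow : ∀ u : ι → ℝ≥0∞, ∑ F ∈ S, (u F * m F ^ (1 / s)) ^ s = ∑ F ∈ S, u F ^ s * m F := by
    intro u
    refine Finset.sum_congr rfl fun F _ => ?_
    rw [ENNReal.mul_rpow_of_nonneg _ _ hs0.le, ← ENNReal.rpow_mul, one_div_mul_cancel hs0.ne',
      ENNReal.rpow_one]
  simp only [← add_mul] at hmink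
  have hBsum : ∑ F ∈ S, (b F + B' F) ^ s * m F = ∑ F ∈ S, B F ^ s * m F :=
    Finset.sum_congr rfl fun F hF => by rw [hBB' F hF]
  rw [hpow b, hpow B', hpow fun F => b F + B' F, hBsum] at hmink
  set X := ∑ F ∈ S, B F ^ s * m F with hX
  set Y := ∑ F ∈ S, b F ^ s * m F with hY
  have hXtop : X ^ (1 / s) ≠ ∞ := by
    refine ENNReal.rpow_ne_top_of_nonneg (by positivity) (ENNReal.sum_ne_top.2 fun F hF => ?_)
    refine ENNReal.mul_ne_top (ENNReal.rpow_ne_top_of_nonneg hs0.le ?_) (hm F hF)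
    exact ENNReal.sum_ne_top.2 fun R hR => hb R (Finset.mem_filter.1 hR).1
  have h1 : X ^ (1 / s) ≤ Y ^ (1 / s) + θ ^ (1 / s) * X ^ (1 / s) := by
    refine hmink.trans ?_
    rw [← ENNReal.mul_rpow_of_nonneg _ _ (by positivity)]
    gcongr
  have ht : θ ^ (1 / s) < 1 := ENNReal.rpow_lt_one hθ (by positivity)
  have h2 : (1 - θ ^ (1 / s)) * X ^ (1 / s) ≤ Y ^ (1 / s) := by
    rw [ENNReal.sub_mul (fun _ _ => hXtop), one_mul]
    exact tsub_le_iff_right.2 h1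
  have h3 : X ^ (1 / s) ≤ (1 - θ ^ (1 / s))⁻¹ * Y ^ (1 / s) := by
    rwa [mul_comm, ← div_eq_mul_inv, ENNReal.le_div_iff_mul_le
      (Or.inl (tsub_pos_of_lt ht).ne') (Or.inl (ENNReal.sub_ne_top ENNReal.one_ne_top)), mul_comm]
  have h4 := ENNReal.rpow_le_rpow h3 hs0.le
  rw [ENNReal.mul_rpow_of_nonneg _ _ hs0.le, ← ENNReal.rpow_mul, ← ENNReal.rpow_mul,
    one_div_mul_cancel hs0.ne', ENNReal.rpow_one, ENNReal.rpow_one] at h4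
  exact h4

/-- The cancellation step of duality arguments. -/
theorem le_rpow_of_le_mul_rpow {r r' : ℝ} (hr : r.HolderConjugate r') {X N : ℝ≥0∞} (hX : X ≠ ∞)
    (h : X ≤ N * X ^ (1 / r')) : X ≤ N ^ r := by
  have hr0' := hr.symm.pos
  by_cases hX0 : X = 0
  · rw [hX0]
    exact zero_le
  have e3 : X ^ (1 / r) * X ^ (1 / r') = X := by
    rw [← ENNReal.rpow_add _ _ hX0 hX]
    have := hr.inv_add_inv_eq_one
    simp [one_div, this]
  have h2 : X ^ (1 / r) ≤ N := by
    refine (ENNReal.mul_le_mul_iff_left (c := X ^ (1 / r')) ?_ ?_).1 (e3.trans_le h)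
    · simp [hX0, hX]
    · exact ENNReal.rpow_ne_top_of_nonneg (by positivity) hX
  have h3 := ENNReal.rpow_le_rpow h2 hr.pos.le
  rwa [← ENNReal.rpow_mul, one_div_mul_cancel hr.pos.ne', ENNReal.rpow_one] at h3

/-- A Carleson embedding in dual form: if the functional `b ↦ ∑ b_F A_F` is bounded by the weighted
`ℓ^{r'}` norm of the coefficients, then the averages `A_F / m_F` are bounded in the weighted space
`ℓ^r`. -/
theorem sum_average_rpow_le {κ : Type*} {r r' : ℝ} (hr : r.HolderConjugate r') {S : Finset κ}
    {A m : κ → ℝ≥0∞} (hm0 : ∀ F ∈ S, m F ≠ 0) (hm : ∀ F ∈ S, m F ≠ ∞) (hA : ∀ F ∈ S, A F ≠ ∞)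
    {K : ℝ≥0∞} (h : ∀ b : κ → ℝ≥0∞, (∀ F ∈ S, b F ≠ ∞) →
      ∑ F ∈ S, b F * A F ≤ (K * ∑ F ∈ S, b F ^ r' * m F) ^ (1 / r')) :
    ∑ F ∈ S, (A F / m F) ^ r * m F ≤ K ^ (r - 1) := by
  set X := ∑ F ∈ S, (A F / m F) ^ r * m F with hX
  have hr0 := hr.pos
  have hr0' := hr.symm.pos
  have hr1 := hr.lt
  have hc : ∀ F ∈ S, A F / m F ≠ ∞ := fun F hF => ENNReal.div_ne_top (hA F hF) (hm0 F hF)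
  have hXtop : X ≠ ∞ := ENNReal.sum_ne_top.2 fun F hF =>
    ENNReal.mul_ne_top (ENNReal.rpow_ne_top_of_nonneg hr0.le (hc F hF)) (hm F hF)
  have h1 := h (fun F => (A F / m F) ^ (r - 1)) fun F hF =>
    ENNReal.rpow_ne_top_of_nonneg (by linarith) (hc F hF)
  have e1 : ∑ F ∈ S, (A F / m F) ^ (r - 1) * A F = X := by
    refine Finset.sum_congr rfl fun F hF => ?_
    calc (A F / m F) ^ (r - 1) * A F = (A F / m F) ^ (r - 1) * ((A F / m F) ^ (1 : ℝ) * m F) := by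
          rw [ENNReal.rpow_one, ENNReal.div_mul_cancel (hm0 F hF) (hm F hF)]
      _ = (A F / m F) ^ r * m F := by
          rw [← mul_assoc, ← ENNReal.rpow_add_of_nonneg _ _ (by linarith) zero_le_one,
            sub_add_cancel]
  have e2 : ∑ F ∈ S, ((A F / m F) ^ (r - 1)) ^ r' * m F = X := by
    refine Finset.sum_congr rfl fun F hF => ?_
    rw [← ENNReal.rpow_mul, hr.sub_one_mul_conj]
  rw [e1, e2, ENNReal.mul_rpow_of_nonneg _ _ (by positivity)] at h1
  have h3 := le_rpow_of_le_mul_rpow hr hXtop h1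
  rw [← ENNReal.rpow_mul] at h3
  convert h3 using 2
  rw [one_div_mul_eq_div]
  have := hr.sub_one_mul_conj
  field_simp
  linarith

/-- Summation over a stopping family. On the elements `Q` stopped at `F` the quantity `A_Q` is at
most twice the average of `A` at `F` times `ν_F(Q)`, and `H_Q` splits into a part `N` living off the
children of `F` and a part `R` living on them; the testing inequalities at each `F` then add up by
Hölder's inequality. -/
theorem stopping_sum_le {r r' : ℝ} (hr : r.HolderConjugate r') {s S : Finset ι}
    {A H m lam N R : ι → ℝ≥0∞} {ν HE HC : ι → ι → ℝ≥0∞} {T X : ℝ≥0∞}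
    (hdom : ∀ Q ∈ s, ∃ F ∈ S, Q ≤ F ∧ A Q ≤ 2 * (A F / m F) * ν F Q ∧ H Q ≤ HE F Q + HC F Q)
    (hX : ∑ F ∈ S, (A F / m F) ^ r * m F ≤ X)
    (hE : ∀ F ∈ S, ∀ t ⊆ s, (∀ Q ∈ t, Q ≤ F) →
      ∑ Q ∈ t, lam Q * ν F Q * HE F Q ≤ T * m F ^ (1 / r) * N F)
    (hC : ∀ F ∈ S, ∀ t ⊆ s, (∀ Q ∈ t, Q ≤ F) →
      ∑ Q ∈ t, lam Q * ν F Q * HC F Q ≤ T * m F ^ (1 / r) * R F)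
    (hN : ∑ F ∈ S, N F ^ r' ≤ 1) (hR : ∑ F ∈ S, R F ^ r' ≤ X) :
    ∑ Q ∈ s, lam Q * A Q * H Q ≤ 2 * X ^ (1 / r) * (1 + X ^ (1 / r')) * T := by
  classical
  have hr0 := hr.pos
  have hr0' := hr.symm.pos
  choose! π hπS hπ hA hH using hdom
  have holder (N : ι → ℝ≥0∞) {Y : ℝ≥0∞} (hY : ∑ F ∈ S, N F ^ r' ≤ Y) :
      ∑ F ∈ S, 2 * (A F / m F) * (T * m F ^ (1 / r) * N F)
        ≤ 2 * T * (X ^ (1 / r) * Y ^ (1 / r')) := by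
    have h1 := ENNReal.inner_le_Lp_mul_Lq S (fun F => A F / m F * m F ^ (1 / r)) N hr
    have e1 : ∀ F ∈ S, (A F / m F * m F ^ (1 / r)) ^ r = (A F / m F) ^ r * m F := by
      intro F _
      rw [ENNReal.mul_rpow_of_nonneg _ _ hr0.le, ← ENNReal.rpow_mul, one_div_mul_cancel hr0.ne',
        ENNReal.rpow_one]
    rw [Finset.sum_congr rfl e1] at h1
    calc _ = 2 * T * ∑ F ∈ S, A F / m F * m F ^ (1 / r) * N F := by
          rw [Finset.mul_sum]
          exact Finset.sum_congr rfl fun _ _ => by ring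
      _ ≤ _ := by
          gcongr
          refine h1.trans ?_
          gcongr
  calc ∑ Q ∈ s, lam Q * A Q * H Q
      = ∑ F ∈ S, ∑ Q ∈ s.filter (π · = F), lam Q * A Q * H Q :=
        (Finset.sum_fiberwise_of_maps_to hπS _).symm
    _ ≤ ∑ F ∈ S, ∑ Q ∈ s.filter (π · = F), 2 * (A F / m F) *
          (lam Q * ν F Q * HE F Q + lam Q * ν F Q * HC F Q) := by
        refine Finset.sum_le_sum fun F _ => Finset.sum_le_sum fun Q hQ => ?_
        obtain ⟨hQs, rfl⟩ := Finset.mem_filter.1 hQ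
        calc lam Q * A Q * H Q ≤ lam Q * (2 * (A (π Q) / m (π Q)) * ν (π Q) Q) *
              (HE (π Q) Q + HC (π Q) Q) := by
              gcongr
              exacts [hA Q hQs, hH Q hQs]
          _ = _ := by ring
    _ ≤ ∑ F ∈ S, 2 * (A F / m F) * (T * m F ^ (1 / r) * N F + T * m F ^ (1 / r) * R F) := by
        refine Finset.sum_le_sum fun F hF => ?_
        have hle : ∀ Q ∈ s.filter (π · = F), Q ≤ F := by
          intro Q hQ
          obtain ⟨hQs, rfl⟩ := Finset.mem_filter.1 hQ
          exact hπ Q hQs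
        rw [← Finset.mul_sum, Finset.sum_add_distrib]
        gcongr
        · exact hE F hF _ (Finset.filter_subset _ _) hle
        · exact hC F hF _ (Finset.filter_subset _ _) hle
    _ ≤ 2 * T * (X ^ (1 / r) * 1 ^ (1 / r')) + 2 * T * (X ^ (1 / r) * X ^ (1 / r')) := by
        simp only [mul_add, Finset.sum_add_distrib]
        gcongr
        · exact holder N hN
        · exact holder R hR
    _ = _ := by
        rw [ENNReal.one_rpow]
        ring

end Stopping

/-! ### The mixed norm -/

section MixedNorm

variable {n : ℕ} {σ : Measure (Fin n → ℝ)}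

@[simp] theorem enorm_NNReal (x : ℝ≥0) : ‖x‖ₑ = (x : ℝ≥0∞) := rfl

instance : SFinite eta := by
  unfold eta
  infer_instance

theorem lintegral_eta (u : Set.Ioi (0 : ℝ) → ℝ≥0∞) :
    ∫⁻ t, u t ∂eta = ∑' k : ℤ, u (twoPow (-k)) := by
  rw [eta, lintegral_sum_measure, ← (Equiv.neg ℤ).tsum_eq]
  simp

theorem lintegral_prod_eta {h : HalfSpace n → ℝ≥0∞} (hh : AEMeasurable h (σ.prod eta)) :
    ∫⁻ z, h z ∂(σ.prod eta) = ∫⁻ x, ∑' k : ℤ, h (x, twoPow (-k)) ∂σ := by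
  rw [lintegral_prod _ hh]
  simp_rw [lintegral_eta]

theorem aemeasurable_slice [SFinite σ] {β : Type*} [MeasurableSpace β] {h : HalfSpace n → β}
    (hh : AEMeasurable h (σ.prod eta)) (k : ℤ) : AEMeasurable (fun x => h (x, twoPow k)) σ := by
  have h1 : Measure.dirac (twoPow k) ≪ eta :=
    (Measure.le_sum (fun k : ℤ => Measure.dirac (twoPow k)) k).absolutelyContinuous
  have h2 : AEMeasurable h (σ.prod (Measure.dirac (twoPow k))) :=
    hh.mono_ac (Measure.AbsolutelyContinuous.rfl.prod h1)
  rw [Measure.prod_dirac] at h2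
  exact h2.comp_aemeasurable (by fun_prop)

theorem aemeasurable_ell2Norm [SFinite σ] {f : HalfSpace n → ℝ≥0}
    (hf : AEMeasurable f (σ.prod eta)) : AEMeasurable (ell2Norm f) σ := by
  unfold ell2Norm
  refine AEMeasurable.pow_const (AEMeasurable.tsum fun k => ?_) _
  exact ((aemeasurable_slice hf (-k)).coe_nnreal_ennreal).pow_const 2

theorem ell2Norm_sq {E : Type*} [ENorm E] (f : HalfSpace n → E) (x : Fin n → ℝ) :
    ell2Norm f x ^ (2 : ℝ) = ∑' k : ℤ, ‖f (x, twoPow (-k))‖ₑ ^ 2 := by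
  rw [ell2Norm, ← ENNReal.rpow_mul]
  norm_num

theorem ell2Norm_rpow {E : Type*} [ENorm E] (f : HalfSpace n → E) (x : Fin n → ℝ) (p : ℝ) :
    ell2Norm f x ^ p = (∑' k : ℤ, ‖f (x, twoPow (-k))‖ₑ ^ 2) ^ (p / 2) := by
  rw [ell2Norm, ← ENNReal.rpow_mul]
  congr 1
  ring

theorem ell2Norm_mono {E F : Type*} [ENorm E] [ENorm F] {f : HalfSpace n → E}
    {h : HalfSpace n → F} {x : Fin n → ℝ} (hfh : ∀ t, ‖f (x, t)‖ₑ ≤ ‖h (x, t)‖ₑ) :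
    ell2Norm f x ≤ ell2Norm h x := by
  unfold ell2Norm
  gcongr
  exact hfh _

theorem ell2Norm_const_mul {c : (Fin n → ℝ) → ℝ≥0} (f : HalfSpace n → ℝ≥0) (x : Fin n → ℝ) :
    ell2Norm (fun z => c z.1 * f z) x = c x * ell2Norm f x := by
  unfold ell2Norm
  simp only [enorm_NNReal, ENNReal.coe_mul, mul_pow]
  rw [ENNReal.tsum_mul_left, ENNReal.mul_rpow_of_nonneg _ _ (by norm_num), ← ENNReal.rpow_natCast,
    ← ENNReal.rpow_mul]
  norm_num

theorem eLpNorm_rpow {α : Type*} [MeasurableSpace α] {ρ : Measure α} {E : Type*} [ENorm E] {p : ℝ}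
    (hp : 0 < p) (f : α → E) : eLpNorm f (ENNReal.ofReal p) ρ ^ p = ∫⁻ x, ‖f x‖ₑ ^ p ∂ρ := by
  rw [eLpNorm_eq_lintegral_rpow_enorm_toReal (by simpa using hp) ENNReal.ofReal_ne_top,
    ENNReal.toReal_ofReal hp.le, ← ENNReal.rpow_mul, one_div_mul_cancel hp.ne', ENNReal.rpow_one]

theorem eLpNorm_eq {α : Type*} [MeasurableSpace α] {ρ : Measure α} {E : Type*} [ENorm E] {p : ℝ}
    (hp : 0 < p) (f : α → E) :
    eLpNorm f (ENNReal.ofReal p) ρ = (∫⁻ x, ‖f x‖ₑ ^ p ∂ρ) ^ (1 / p) := by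
  rw [← eLpNorm_rpow hp, ← ENNReal.rpow_mul, mul_one_div_cancel hp.ne', ENNReal.rpow_one]

theorem mixedNorm_rpow {E : Type*} [ENorm E] {p : ℝ} (hp : 0 < p) (f : HalfSpace n → E) :
    mixedNorm p σ f ^ p = ∫⁻ x, ell2Norm f x ^ p ∂σ := by
  simp [mixedNorm, eLpNorm_rpow hp]

theorem mixedNorm_eq {E : Type*} [ENorm E] {p : ℝ} (hp : 0 < p) (f : HalfSpace n → E) :
    mixedNorm p σ f = (∫⁻ x, ell2Norm f x ^ p ∂σ) ^ (1 / p) := by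
  simp [mixedNorm, eLpNorm_eq hp]

theorem mixedNorm_const_mul {p : ℝ} (hp : 0 < p) (c : ℝ≥0) (f : HalfSpace n → ℝ≥0) :
    mixedNorm p σ (fun z => c * f z) = c * mixedNorm p σ f := by
  simp_rw [mixedNorm_eq hp, ell2Norm_const_mul (c := fun _ => c),
    ENNReal.mul_rpow_of_nonneg _ _ hp.le]
  rw [lintegral_const_mul' _ _ (by simp [hp.le]), ENNReal.mul_rpow_of_nonneg _ _ (by positivity),
    ← ENNReal.rpow_mul, mul_one_div_cancel hp.ne', ENNReal.rpow_one]

theorem tsum_mul_le {a b : ℤ → ℝ≥0∞} :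
    ∑' k, a k * b k ≤ (∑' k, a k ^ 2) ^ (1 / 2 : ℝ) * (∑' k, b k ^ 2) ^ (1 / 2 : ℝ) := by
  have h := ENNReal.lintegral_mul_le_Lp_mul_Lq (Measure.count : Measure ℤ)
    (p := 2) (q := 2) ⟨by norm_num, by norm_num, by norm_num⟩ (f := a) (g := b)
    (measurable_of_countable _).aemeasurable (measurable_of_countable _).aemeasurable
  simp only [lintegral_count, Pi.mul_apply] at h
  exact_mod_cast h

/-- Hölder's inequality for the mixed norms. -/
theorem lintegral_mul_le_mixedNorm [SFinite σ] {p p' : ℝ} (hpp' : p.HolderConjugate p')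
    {f h : HalfSpace n → ℝ≥0} (hf : AEMeasurable f (σ.prod eta))
    (hh : AEMeasurable h (σ.prod eta)) :
    ∫⁻ z, (f z : ℝ≥0∞) * (h z : ℝ≥0∞) ∂(σ.prod eta) ≤ mixedNorm p σ f * mixedNorm p' σ h := by
  have hm : AEMeasurable (fun z => (f z : ℝ≥0∞) * (h z : ℝ≥0∞)) (σ.prod eta) :=
    hf.coe_nnreal_ennreal.mul hh.coe_nnreal_ennreal
  rw [lintegral_prod_eta hm, mixedNorm_eq hpp'.pos, mixedNorm_eq hpp'.symm.pos]
  refine le_trans ?_ (ENNReal.lintegral_mul_le_Lp_mul_Lq σ hpp' (aemeasurable_ell2Norm hf)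
    (aemeasurable_ell2Norm hh))
  refine lintegral_mono fun x => ?_
  simpa [ell2Norm] using tsum_mul_le

theorem aemeasurable_indicator_box {f : HalfSpace n → ℝ≥0} (hf : AEMeasurable f (σ.prod eta))
    (Q : DyadicCube n) : AEMeasurable (Q.box.indicator f) (σ.prod eta) :=
  hf.indicator Q.measurableSet_box

/-- If at most one of the functions `h i` is nonzero somewhere on the vertical line over `x`, the
`p`-th powers of the `ℓ²` norms on this line add up. -/
theorem ell2Norm_sum_rpow_le {ι : Type*} {S : Finset ι} {h : ι → HalfSpace n → ℝ≥0} {p : ℝ}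
    (hp : 0 < p) {x : Fin n → ℝ}
    (hdisj : ∀ i ∈ S, ∀ j ∈ S, ∀ t t', h i (x, t) ≠ 0 → h j (x, t') ≠ 0 → i = j) :
    ell2Norm (fun z => ∑ i ∈ S, h i z) x ^ p ≤ ∑ i ∈ S, ell2Norm (h i) x ^ p := by
  by_cases hex : ∃ i ∈ S, ∃ t, h i (x, t) ≠ 0
  · obtain ⟨i, hi, t, hit⟩ := hex
    refine le_trans ?_ (Finset.single_le_sum (fun _ _ => zero_le) hi)
    gcongr
    refine ell2Norm_mono fun t' => ?_
    rw [Finset.sum_eq_single_of_mem i hi]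
    intro j hj hji
    by_contra hne
    exact hji (hdisj j hj i hi _ _ hne hit)
  · push Not at hex
    have : ell2Norm (fun z => ∑ i ∈ S, h i z) x = 0 := by
      unfold ell2Norm
      simp [Finset.sum_eq_zero fun i hi => hex i hi _]
    simp [this, hp]

end MixedNorm

/-! ### The box norms and the test functions -/

section TestFunctions

variable {n : ℕ} {σ : Measure (Fin n → ℝ)} {μ : HalfSpace n → ℝ≥0}

/-- `M_Q = ‖1_{Q̂} μ‖_{L^{p'}(σ; ℓ²)} ^ p'`, the natural weight of the cube `Q`. -/
noncomputable def boxMass (p' : ℝ) (σ : Measure (Fin n → ℝ)) (μ : HalfSpace n → ℝ≥0)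
    (Q : DyadicCube n) : ℝ≥0∞ :=
  ∫⁻ x, ell2Norm (Q.box.indicator μ) x ^ p' ∂σ

theorem ell2Norm_indicator_box_of_notMem {Q : DyadicCube n} {x : Fin n → ℝ} (hx : x ∉ Q.toSet) :
    ell2Norm (Q.box.indicator μ) x = 0 := by
  have (t : Set.Ioi (0 : ℝ)) : (x, t) ∉ Q.box := fun h => hx h.1
  simp [ell2Norm, this]

theorem ell2Norm_indicator_box_mono {Q R : DyadicCube n} (h : Q ≤ R) (x : Fin n → ℝ) :
    ell2Norm (Q.box.indicator μ) x ≤ ell2Norm (R.box.indicator μ) x := by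
  refine ell2Norm_mono fun t => ?_
  simp only [enorm_NNReal, ENNReal.coe_le_coe]
  exact Set.indicator_le_indicator_of_subset (DyadicCube.box_subset_box h) (fun _ => zero_le) _

/-- The factor `|1_{Q̂} μ|_{ℓ²} ^ (p' - 2)` of the test function. -/
noncomputable def testFactor (p' : ℝ) (μ : HalfSpace n → ℝ≥0) (Q : DyadicCube n)
    (x : Fin n → ℝ) : ℝ≥0 :=
  (ell2Norm (Q.box.indicator μ) x ^ (p' - 2)).toNNReal

theorem testFun_eq (p' : ℝ) (Q : DyadicCube n) :
    testFun μ p' Q = fun z => testFactor p' μ Q z.1 * Q.box.indicator μ z := rfl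

theorem aemeasurable_testFun [SFinite σ] (hμ : AEMeasurable μ (σ.prod eta)) (p' : ℝ)
    (Q : DyadicCube n) : AEMeasurable (testFun μ p' Q) (σ.prod eta) := by
  have h := aemeasurable_indicator_box hμ Q
  have h1 : AEMeasurable (testFactor p' μ Q) σ :=
    ((aemeasurable_ell2Norm h).pow_const _).ennreal_toNNReal
  exact (h1.comp_quasiMeasurePreserving Measure.quasiMeasurePreserving_fst).mul h

theorem toNNReal_rpow_mul_sq {a : ℝ≥0∞} (ha : a ≠ ∞) {q : ℝ} (hq : 0 < q) :
    ((a ^ (q - 2)).toNNReal : ℝ≥0∞) * a ^ (2 : ℝ) = a ^ q := by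
  rcases eq_or_ne a 0 with rfl | h0
  · simp [hq]
  · rw [ENNReal.coe_toNNReal (ENNReal.rpow_ne_top_of_ne_zero h0 ha), ← ENNReal.rpow_add _ _ h0 ha]
    simp

theorem toNNReal_rpow_mul_rpow {a : ℝ≥0∞} (ha : a ≠ ∞) {p q : ℝ} (h : p.HolderConjugate q) :
    (((a ^ (q - 2)).toNNReal : ℝ≥0∞) * a) ^ p = a ^ q := by
  have hq := h.symm.pos
  rcases eq_or_ne a 0 with rfl | h0
  · simp [hq, h.pos]
  · rw [ENNReal.coe_toNNReal (ENNReal.rpow_ne_top_of_ne_zero h0 ha)]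
    conv_lhs => rw [← ENNReal.rpow_one a, ← ENNReal.rpow_mul, one_mul,
      ← ENNReal.rpow_add _ _ h0 ha, ← ENNReal.rpow_mul]
    congr 1
    have := h.symm.sub_one_mul_conj
    linarith

/-- The pointwise inequality behind the decay of the box masses: with `θ = 2 ^ (-q / 2)`, Young's
inequality bounds `c ^ q = θ (2 a ^ (q - 2) c ^ 2) ^ (q / 2) (a ^ q) ^ (1 - q / 2)`. -/
theorem rpow_le_young {a c : ℝ≥0∞} (ha : a ≠ ∞) (hca : c ≤ a) {q : ℝ} (hq : 0 < q) (hq2 : q ≤ 2) :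
    c ^ q ≤ 2 ^ (-(q / 2)) * (ENNReal.ofReal (q / 2) *
      (2 * (((a ^ (q - 2)).toNNReal : ℝ≥0∞) * c ^ (2 : ℝ))) +
        ENNReal.ofReal (1 - q / 2) * a ^ q) := by
  rcases eq_or_ne c 0 with rfl | hc0
  · simp [hq]
  have h0 : a ≠ 0 := (pos_of_ne_zero hc0 |>.trans_le hca).ne'
  have hc : c ≠ ∞ := ne_top_of_le_ne_top ha hca
  set τ := ((a ^ (q - 2)).toNNReal : ℝ≥0∞) with hτ
  have hτ' : τ = a ^ (q - 2) := ENNReal.coe_toNNReal (ENNReal.rpow_ne_top_of_ne_zero h0 ha)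
  have hy : (2 * (τ * c ^ (2 : ℝ))) ^ (q / 2) * (a ^ q) ^ (1 - q / 2) ≤
      ENNReal.ofReal (q / 2) * (2 * (τ * c ^ (2 : ℝ))) + ENNReal.ofReal (1 - q / 2) * a ^ q := by
    have hx : 2 * (τ * c ^ (2 : ℝ)) ≠ ∞ := by
      refine ENNReal.mul_ne_top (by simp) (ENNReal.mul_ne_top (by simp [hτ]) ?_)
      exact ENNReal.rpow_ne_top_of_nonneg (by norm_num) hc
    have hy : a ^ q ≠ ∞ := ENNReal.rpow_ne_top_of_nonneg hq.le ha
    generalize 2 * (τ * c ^ (2 : ℝ)) = x at *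
    generalize a ^ q = y at *
    lift x to ℝ≥0 using hx
    lift y to ℝ≥0 using hy
    rw [← ENNReal.coe_rpow_of_nonneg _ (by linarith), ← ENNReal.coe_rpow_of_nonneg _ (by linarith)]
    rw [ENNReal.ofReal, ENNReal.ofReal]
    norm_cast
    have := NNReal.geom_mean_le_arith_mean2_weighted (q / 2).toNNReal (1 - q / 2).toNNReal x y
      (by rw [← Real.toNNReal_add (by linarith) (by linarith)]; simp)
    rwa [Real.coe_toNNReal _ (by linarith), Real.coe_toNNReal _ (by linarith)] at this
  refine le_trans (le_of_eq ?_) (mul_le_mul_right hy _)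
  rw [ENNReal.mul_rpow_of_nonneg _ _ (by linarith),
    ENNReal.mul_rpow_of_nonneg _ _ (by linarith), hτ', ← ENNReal.rpow_mul,
    ← ENNReal.rpow_mul, ← ENNReal.rpow_mul]
  have e1 : (2 : ℝ≥0∞) ^ (-(q / 2)) * 2 ^ (q / 2) = 1 := by
    rw [← ENNReal.rpow_add _ _ (by simp) (by simp)]
    simp
  have e2 : a ^ ((q - 2) * (q / 2)) * a ^ (q * (1 - q / 2)) = 1 := by
    rw [← ENNReal.rpow_add _ _ h0 ha]
    convert ENNReal.rpow_zero using 2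
    ring
  calc c ^ q = (2 ^ (-(q / 2)) * 2 ^ (q / 2)) * (a ^ ((q - 2) * (q / 2)) * a ^ (q * (1 - q / 2)))
        * c ^ (2 * (q / 2)) := by
        rw [e1, e2, one_mul, one_mul, mul_div_cancel₀ _ two_ne_zero]
    _ = _ := by ring

theorem boxMass_eq {p' : ℝ} (hp' : 0 < p') (Q : DyadicCube n) :
    mixedNorm p' σ (Q.box.indicator μ) = boxMass p' σ μ Q ^ (1 / p') :=
  mixedNorm_eq hp' _

theorem boxMass_lt_top {p' : ℝ} (hp' : 0 < p') {Q : DyadicCube n}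
    (h : mixedNorm p' σ (Q.box.indicator μ) < ∞) : boxMass p' σ μ Q < ∞ := by
  rw [boxMass, ← mixedNorm_rpow hp']
  exact ENNReal.rpow_lt_top_of_nonneg hp'.le h.ne

theorem ae_ell2Norm_lt_top [SFinite σ] (hμ : AEMeasurable μ (σ.prod eta)) {p' : ℝ} (hp' : 0 < p')
    {Q : DyadicCube n} (h : boxMass p' σ μ Q ≠ ∞) :
    ∀ᵐ x ∂σ, ell2Norm (Q.box.indicator μ) x ≠ ∞ := by
  have := ae_lt_top' ((aemeasurable_ell2Norm (aemeasurable_indicator_box hμ Q)).pow_const p') h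
  filter_upwards [this] with x hx hx'
  simp [hx', hp'] at hx

/-- `ν_R(Q) = ∬_{Q̂} φ_R μ`. -/
noncomputable def testMass (p' : ℝ) (σ : Measure (Fin n → ℝ)) (μ : HalfSpace n → ℝ≥0)
    (R Q : DyadicCube n) : ℝ≥0∞ :=
  ∫⁻ z in Q.box, (testFun μ p' R z : ℝ≥0∞) * (μ z : ℝ≥0∞) ∂(σ.prod eta)

theorem testMass_eq [SFinite σ] (hμ : AEMeasurable μ (σ.prod eta)) (p' : ℝ) {Q R : DyadicCube n}
    (h : Q ≤ R) : testMass p' σ μ R Q =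
      ∫⁻ x, (testFactor p' μ R x : ℝ≥0∞) * ell2Norm (Q.box.indicator μ) x ^ (2 : ℝ) ∂σ := by
  rw [testMass, ← lintegral_indicator Q.measurableSet_box, lintegral_prod_eta]
  · refine lintegral_congr fun x => ?_
    rw [ell2Norm_sq, ← ENNReal.tsum_mul_left]
    refine tsum_congr fun k => ?_
    by_cases hk : (x, twoPow (-k)) ∈ Q.box
    · simp only [Set.indicator_of_mem hk, testFun_eq,
        Set.indicator_of_mem (DyadicCube.box_subset_box h hk), enorm_NNReal]
      push_cast
      ring
    · simp [hk]
  · exact ((aemeasurable_testFun hμ p' R).coe_nnreal_ennreal.mul hμ.coe_nnreal_ennreal).indicator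
      Q.measurableSet_box

theorem testMass_self [SFinite σ] (hμ : AEMeasurable μ (σ.prod eta)) {p' : ℝ} (hp' : 0 < p')
    {Q : DyadicCube n} (h : boxMass p' σ μ Q ≠ ∞) : testMass p' σ μ Q Q = boxMass p' σ μ Q := by
  rw [testMass_eq hμ p' le_rfl, boxMass]
  refine lintegral_congr_ae ?_
  filter_upwards [ae_ell2Norm_lt_top hμ hp' h] with x hx
  exact toNNReal_rpow_mul_sq hx hp'

theorem mixedNorm_testFun [SFinite σ] (hμ : AEMeasurable μ (σ.prod eta)) {p p' : ℝ}
    (hpp' : p.HolderConjugate p') {Q : DyadicCube n} (h : boxMass p' σ μ Q ≠ ∞) :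
    mixedNorm p σ (testFun μ p' Q) = boxMass p' σ μ Q ^ (1 / p) := by
  rw [mixedNorm_eq hpp'.pos, boxMass]
  congr 1
  refine lintegral_congr_ae ?_
  filter_upwards [ae_ell2Norm_lt_top hμ hpp'.symm.pos h] with x hx
  rw [testFun_eq, ell2Norm_const_mul]
  exact toNNReal_rpow_mul_rpow hx hpp'

/-- If the cubes of a disjoint family inside `R` carry at most half of `ν_R`, then they carry at
most the fraction `2 ^ (-p' / 2)` of the box mass of `R`; this uses `p' ≤ 2`. -/
theorem sum_boxMass_le [SFinite σ] (hμ : AEMeasurable μ (σ.prod eta)) {p' : ℝ} (hp' : 0 < p')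
    (hp2 : p' ≤ 2) {R : DyadicCube n} (hR : boxMass p' σ μ R ≠ ∞) {T : Finset (DyadicCube n)}
    (hT : ∀ Q ∈ T, Q ≤ R) (hdisj : ∀ Q ∈ T, ∀ Q' ∈ T, Q ≤ Q' → Q = Q')
    (hν : 2 * ∑ Q ∈ T, testMass p' σ μ R Q ≤ boxMass p' σ μ R) :
    ∑ Q ∈ T, boxMass p' σ μ Q ≤ 2 ^ (-(p' / 2)) * boxMass p' σ μ R := by
  have hae := ae_ell2Norm_lt_top hμ hp' hR
  have hmeas (Q : DyadicCube n) := aemeasurable_ell2Norm (aemeasurable_indicator_box hμ Q)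
  have hmeasF : AEMeasurable (fun x => (testFactor p' μ R x : ℝ≥0∞)) σ :=
    ((hmeas R).pow_const _).ennreal_toNNReal.coe_nnreal_ennreal
  have hind (Q : DyadicCube n) : AEMeasurable
      (Q.toSet.indicator fun x => ell2Norm (R.box.indicator μ) x ^ p') σ :=
    ((hmeas R).pow_const _).indicator Q.measurableSet_toSet
  have h1 : ∀ Q ∈ T, boxMass p' σ μ Q ≤ 2 ^ (-(p' / 2)) * (ENNReal.ofReal (p' / 2) *
      (2 * testMass p' σ μ R Q) + ENNReal.ofReal (1 - p' / 2) *
        ∫⁻ x, Q.toSet.indicator (fun x => ell2Norm (R.box.indicator μ) x ^ p') x ∂σ) := by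
    intro Q hQ
    have m1 : AEMeasurable (fun x => (testFactor p' μ R x : ℝ≥0∞) *
        ell2Norm (Q.box.indicator μ) x ^ (2 : ℝ)) σ := hmeasF.mul ((hmeas Q).pow_const _)
    rw [testMass_eq hμ p' (hT Q hQ), ← lintegral_const_mul'' _ m1,
      ← lintegral_const_mul'' _ (m1.const_mul _), ← lintegral_const_mul'' _ (hind Q),
      ← lintegral_add_left' ((m1.const_mul _).const_mul _),
      ← lintegral_const_mul' _ _ (by simp)]
    refine lintegral_mono_ae ?_
    filter_upwards [hae] with x hx
    by_cases hxQ : x ∈ Q.toSet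
    · rw [Set.indicator_of_mem hxQ]
      exact rpow_le_young hx (ell2Norm_indicator_box_mono (hT Q hQ) x) hp' hp2
    · simp [ell2Norm_indicator_box_of_notMem hxQ, hp']
  have h2 : ∑ Q ∈ T, ∫⁻ x, Q.toSet.indicator (fun x => ell2Norm (R.box.indicator μ) x ^ p') x ∂σ ≤
      boxMass p' σ μ R := by
    rw [← lintegral_finsetSum' _ fun Q _ => hind Q]
    refine lintegral_mono fun x => ?_
    by_cases hex : ∃ Q ∈ T, x ∈ Q.toSet
    · obtain ⟨Q, hQ, hx⟩ := hex
      rw [Finset.sum_eq_single_of_mem Q hQ]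
      · exact Set.indicator_le_self _ _ _
      · intro Q' hQ' hne
        refine Set.indicator_of_notMem (fun hx' => hne ?_) _
        rcases DyadicCube.le_or_le_of_mem hx hx' with h | h
        · exact (hdisj Q hQ Q' hQ' h).symm
        · exact hdisj Q' hQ' Q hQ h
    · push Not at hex
      rw [Finset.sum_eq_zero fun Q hQ => Set.indicator_of_notMem (hex Q hQ) _]
      exact zero_le
  calc ∑ Q ∈ T, boxMass p' σ μ Q ≤ _ := Finset.sum_le_sum h1
    _ = 2 ^ (-(p' / 2)) * (ENNReal.ofReal (p' / 2) * (2 * ∑ Q ∈ T, testMass p' σ μ R Q) +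
        ENNReal.ofReal (1 - p' / 2) * ∑ Q ∈ T,
          ∫⁻ x, Q.toSet.indicator (fun x => ell2Norm (R.box.indicator μ) x ^ p') x ∂σ) := by
        simp only [← Finset.mul_sum, Finset.sum_add_distrib]
    _ ≤ 2 ^ (-(p' / 2)) * (ENNReal.ofReal (p' / 2) * boxMass p' σ μ R +
        ENNReal.ofReal (1 - p' / 2) * boxMass p' σ μ R) := by
        gcongr
    _ = 2 ^ (-(p' / 2)) * boxMass p' σ μ R := by
        rw [← add_mul, ← ENNReal.ofReal_add (by linarith) (by linarith)]
        simp

end TestFunctions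

/-! ### Integrals over nested families of sets -/

theorem finset_rpow_sum_le {ι : Type*} (S : Finset ι) (a : ι → ℝ≥0∞) {p : ℝ} (hp : 0 < p)
    (hp1 : p ≤ 1) : (∑ i ∈ S, a i) ^ p ≤ ∑ i ∈ S, a i ^ p := by
  classical
  induction S using Finset.induction_on with
  | empty => simp [hp]
  | insert i S hi ih =>
    rw [Finset.sum_insert hi, Finset.sum_insert hi]
    exact (ENNReal.rpow_add_le_add_rpow _ _ hp.le hp1).trans (by gcongr)

theorem finset_sum_rpow_le {ι : Type*} (S : Finset ι) (a : ι → ℝ≥0∞) {p : ℝ} (hp1 : 1 ≤ p) :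
    ∑ i ∈ S, a i ^ p ≤ (∑ i ∈ S, a i) ^ p := by
  classical
  induction S using Finset.induction_on with
  | empty => simp
  | insert i S hi ih =>
    rw [Finset.sum_insert hi, Finset.sum_insert hi]
    exact le_trans (by gcongr) (ENNReal.add_rpow_le_rpow_add _ _ hp1)

section Nested

variable {ι Z : Type*} [PartialOrder ι]

/-- A monotone family of sets in which any two sets with a common point are nested. -/
structure IsNested (U : ι → Set Z) : Prop where
  mono : Monotone U
  le_or_le : ∀ ⦃z a b⦄, z ∈ U a → z ∈ U b → a ≤ b ∨ b ≤ a

/-- The points for which `F` is the smallest element of `S` whose set contains the point. -/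
def leastSet (S : Finset ι) (U : ι → Set Z) (F : ι) : Set Z :=
  {z | z ∈ U F ∧ ∀ F' ∈ S, z ∈ U F' → F ≤ F'}

theorem measurableSet_leastSet [MeasurableSpace Z] {U : ι → Set Z} (hU : ∀ a, MeasurableSet (U a))
    (S : Finset ι) (F : ι) : MeasurableSet (leastSet S U F) := by
  have : leastSet S U F = U F ∩ ⋂ F' ∈ S, {z | z ∈ U F' → F ≤ F'} := by
    ext
    simp [leastSet]
  rw [this]
  refine (hU F).inter ?_
  refine Finset.measurableSet_biInter _ fun F' _ => ?_
  by_cases h : F ≤ F'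
  · simp [h]
  · have : {z | z ∈ U F' → F ≤ F'} = (U F')ᶜ := by
      ext
      simp [h]
    rw [this]
    exact (hU F').compl

theorem eq_of_mem_leastSet {S : Finset ι} {U : ι → Set Z} {F F' : ι} (hF : F ∈ S) (hF' : F' ∈ S)
    {z : Z} (h : z ∈ leastSet S U F) (h' : z ∈ leastSet S U F') : F = F' :=
  le_antisymm (h.2 F' hF' h'.1) (h'.2 F hF h.1)

theorem sum_indicator_leastSet_le {S : Finset ι} {U : ι → Set Z} (u : Z → ℝ≥0∞) (z : Z) :
    ∑ F ∈ S, (leastSet S U F).indicator u z ≤ u z := by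
  by_cases hex : ∃ F ∈ S, z ∈ leastSet S U F
  · obtain ⟨F, hF, hz⟩ := hex
    rw [Finset.sum_eq_single_of_mem F hF]
    · exact Set.indicator_le_self _ _ _
    · exact fun F' hF' hne =>
        Set.indicator_of_notMem (fun hz' => hne (eq_of_mem_leastSet hF' hF hz' hz)) _
  · push Not at hex
    rw [Finset.sum_eq_zero fun F hF => Set.indicator_of_notMem (hex F hF) _]
    exact zero_le

theorem eq_of_mem_children_of_mem {S : Finset ι} {U : ι → Set Z} (hU : IsNested U) {R F F' : ι}
    (hF : F ∈ children S R) (hF' : F' ∈ children S R) {z : Z} (h : z ∈ U F) (h' : z ∈ U F') :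
    F = F' :=
  (hU.le_or_le h h').elim (eq_of_le_of_mem_children hF hF')
    fun hle => (eq_of_le_of_mem_children hF' hF hle).symm

theorem mem_leastSet_or_exists_child (hι : IsForest ι) {S : Finset ι} {U : ι → Set Z}
    (hU : IsNested U) {Q F : ι} (hQF : Q ≤ F) (hmin : ∀ F' ∈ S, Q ≤ F' → F ≤ F') {z : Z}
    (hz : z ∈ U Q) :
    z ∈ leastSet S U F ∨ ∃ F' ∈ children S F, F' ≤ Q ∧ z ∈ U F' := by
  by_cases h : z ∈ leastSet S U F
  · exact Or.inl h
  · simp only [leastSet, Set.mem_ofPred_eq, hU.mono hQF hz, true_and] at h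
    push Not at h
    obtain ⟨F', hF', hz', hle⟩ := h
    have hlt : F' < F := lt_of_le_not_ge
      ((hU.le_or_le hz' (hU.mono hQF hz)).resolve_right hle) hle
    obtain ⟨F'', hF'', hle'⟩ := exists_child hι hF' hlt
    refine Or.inr ⟨F'', hF'', ?_, hU.mono hle' hz'⟩
    refine (hU.le_or_le (hU.mono hle' hz') hz).resolve_right fun hQ => ?_
    have := mem_children.1 hF''
    exact (hmin F'' this.1 hQ).not_gt this.2.1

theorem setLIntegral_le_leastSet_add [MeasurableSpace Z] (ρ : Measure Z) (hι : IsForest ι)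
    {S : Finset ι} {U : ι → Set Z} (hU : IsNested U) (hUm : ∀ a, MeasurableSet (U a)) {Q F : ι}
    (hQF : Q ≤ F) (hmin : ∀ F' ∈ S, Q ≤ F' → F ≤ F') (u v : Z → ℝ≥0∞)
    (hv : ∀ F' ∈ children S F, F' ≤ Q → ∫⁻ z in U F', u z ∂ρ ≤ ∫⁻ z in U F', v z ∂ρ) :
    ∫⁻ z in U Q, u z ∂ρ ≤
      ∫⁻ z in U Q, (leastSet S U F).indicator u z ∂ρ + ∫⁻ z in U Q, v z ∂ρ := by
  classical
  set C := (children S F).filter (· ≤ Q) with hC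
  have hdisj : Set.PairwiseDisjoint (↑C : Set ι) U := by
    intro a ha b hb hab
    rw [Function.onFun, Set.disjoint_left]
    exact fun z hz hz' => hab (eq_of_mem_children_of_mem hU
      (Finset.mem_filter.1 ha).1 (Finset.mem_filter.1 hb).1 hz hz')
  have hbi (w : Z → ℝ≥0∞) : ∫⁻ z in ⋃ F' ∈ C, U F', w z ∂ρ = ∑ F' ∈ C, ∫⁻ z in U F', w z ∂ρ :=
    lintegral_biUnion_finset hdisj (fun a _ => hUm a) w
  calc ∫⁻ z in U Q, u z ∂ρ
      ≤ ∫⁻ z in (U Q ∩ leastSet S U F) ∪ ⋃ F' ∈ C, U F', u z ∂ρ := by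
        refine lintegral_mono_set fun z hz => ?_
        rcases mem_leastSet_or_exists_child hι hU hQF hmin hz with h | ⟨F', h, h', h''⟩
        · exact Or.inl ⟨hz, h⟩
        · refine Or.inr (Set.mem_iUnion₂.2 ⟨F', ?_, h''⟩)
          simp [hC, h, h']
    _ ≤ ∫⁻ z in U Q ∩ leastSet S U F, u z ∂ρ + ∫⁻ z in ⋃ F' ∈ C, U F', u z ∂ρ :=
        lintegral_union_le _ _ _
    _ ≤ _ := by
        gcongr ?_ + ?_
        · rw [lintegral_indicator (measurableSet_leastSet hUm S F),
            Measure.restrict_restrict (measurableSet_leastSet hUm S F), Set.inter_comm]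
        · rw [hbi]
          refine (Finset.sum_le_sum fun F' hF' => ?_).trans ((hbi v).symm.trans_le
            (lintegral_mono_set (Set.iUnion₂_subset fun F' hF' =>
              hU.mono (Finset.mem_filter.1 hF').2)))
          exact hv F' (Finset.mem_filter.1 hF').1 (Finset.mem_filter.1 hF').2

theorem sum_children_setLIntegral_le [MeasurableSpace Z] (ρ : Measure Z) {S : Finset ι}
    {U : ι → Set Z} (hU : IsNested U) (hUm : ∀ a, MeasurableSet (U a)) (R : ι) (u : Z → ℝ≥0∞) :
    ∑ F ∈ children S R, ∫⁻ z in U F, u z ∂ρ ≤ ∫⁻ z in U R, u z ∂ρ := by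
  rw [← lintegral_biUnion_finset _ (fun a _ => hUm a)]
  · exact lintegral_mono_set (Set.iUnion₂_subset fun F hF => hU.mono (mem_children.1 hF).2.1.le)
  · intro a ha b hb hab
    rw [Function.onFun, Set.disjoint_left]
    exact fun z hz hz' => hab (eq_of_mem_children_of_mem hU ha hb hz hz')

/-- If `A` more than doubles its average relative to `ν` on each of a family of pieces of a set of
mass `m`, these pieces carry at most half of the mass. -/
theorem two_mul_sum_le {κ : Type*} {T : Finset κ} {A ν : κ → ℝ≥0∞} {a m : ℝ≥0∞} (hm0 : m ≠ 0)
    (hm : m ≠ ∞) (ha : a ≠ ∞) (hsum : ∑ F ∈ T, A F ≤ a) (hbad : ∀ F ∈ T, 2 * (a / m) * ν F < A F) :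
    2 * ∑ F ∈ T, ν F ≤ m := by
  by_cases ha0 : a = 0
  · have : T = ∅ := by
      refine Finset.eq_empty_of_forall_notMem fun F hF => ?_
      have h1 : A F ≤ 0 := (Finset.single_le_sum (fun _ _ => zero_le) hF).trans (hsum.trans ha0.le)
      exact (zero_le.trans_lt (hbad F hF)).not_ge h1
    simp [this]
  · have hc0 : a / m ≠ 0 := ENNReal.div_ne_zero.2 ⟨ha0, hm⟩
    refine (ENNReal.mul_le_mul_iff_right hc0 (ENNReal.div_ne_top ha hm0)).1 ?_
    rw [ENNReal.div_mul_cancel hm0 hm]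
    refine le_trans (le_of_eq ?_) ((Finset.sum_le_sum fun F hF => (hbad F hF).le).trans hsum)
    rw [← Finset.mul_sum]
    ring

theorem sum_children_le {S : Finset ι} {N : ι → ℝ≥0∞} :
    ∑ R ∈ S, ∑ F ∈ children S R, N F ≤ ∑ F ∈ S, N F := by
  classical
  calc ∑ R ∈ S, ∑ F ∈ children S R, N F
      = ∑ R ∈ S, ∑ F ∈ S, if F ∈ children S R then N F else 0 := by
        refine Finset.sum_congr rfl fun R _ => ?_
        rw [← Finset.sum_filter, Finset.filter_mem_eq_inter,
          Finset.inter_eq_right.2 children_subset]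
    _ ≤ ∑ F ∈ S, N F := by
        rw [Finset.sum_comm]
        refine Finset.sum_le_sum fun F _ => ?_
        by_cases hex : ∃ R ∈ S, F ∈ children S R
        · obtain ⟨R, hR, hF⟩ := hex
          rw [Finset.sum_eq_single_of_mem R hR, if_pos hF]
          exact fun R' hR' hne => if_neg fun hF' => hne (children_eq hR' hR hF' hF)
        · push Not at hex
          rw [Finset.sum_eq_zero fun R hR => if_neg (hex R hR)]
          exact zero_le

end Nested

theorem DyadicCube.isForest {n : ℕ} : IsForest (DyadicCube n) := fun _ _ _ =>
  DyadicCube.le_or_le_of_le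

theorem DyadicCube.isNested_toSet {n : ℕ} : IsNested (DyadicCube.toSet (n := n)) :=
  ⟨fun _ _ h => h.2, fun _ _ _ => DyadicCube.le_or_le_of_mem⟩

theorem DyadicCube.isNested_box {n : ℕ} : IsNested (DyadicCube.box (n := n)) :=
  ⟨fun _ _ => DyadicCube.box_subset_box, fun _ _ _ h h' => DyadicCube.le_or_le_of_mem h.1 h'.1⟩

/-! ### Carleson embeddings -/

section Carleson

variable {n : ℕ} {σ ω : Measure (Fin n → ℝ)} {μ : HalfSpace n → ℝ≥0}

/-- The mixed norm of a combination of the functions `1_{F̂} μ` is controlled by the ancestor sums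
of the coefficients. Since `p' ≤ 2`, the power `p' / 2` is subadditive. -/
theorem mixedNorm_sum_indicator_le [SFinite σ] (hμ : AEMeasurable μ (σ.prod eta)) {p' : ℝ}
    (hp' : 0 < p') (hp2 : p' ≤ 2) (S : Finset (DyadicCube n)) (b : DyadicCube n → ℝ≥0) :
    mixedNorm p' σ (fun z => ∑ F ∈ S, b F * F.box.indicator μ z) ≤
      (∑ F ∈ S, ancestorSum S (fun F => (b F : ℝ≥0∞)) F ^ p' * boxMass p' σ μ F) ^ (1 / p') := by
  classical
  rw [mixedNorm_eq hp']
  refine ENNReal.rpow_le_rpow ?_ (by positivity)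
  set B := ancestorSum S (fun F => (b F : ℝ≥0∞)) with hB
  have hpt (z : HalfSpace n) : (((∑ F ∈ S, b F * F.box.indicator μ z : ℝ≥0)) : ℝ≥0∞) ^ 2 ≤
      ∑ F ∈ S, B F ^ (2 : ℝ) * ((F.box.indicator μ z : ℝ≥0) : ℝ≥0∞) ^ 2 := by
    set T := S.filter (z ∈ ·.box)
    have e1 : ((∑ F ∈ S, b F * F.box.indicator μ z : ℝ≥0) : ℝ≥0∞) =
        (∑ F ∈ T, (b F : ℝ≥0∞)) * μ z := by
      push_cast
      rw [Finset.sum_mul, Finset.sum_filter]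
      refine Finset.sum_congr rfl fun F _ => ?_
      by_cases h : z ∈ F.box <;> simp [h]
    have h1 := sum_rpow_le_sum_ancestorSum_rpow (Finset.filter_subset _ _ : T ⊆ S)
      (fun a ha c hc => DyadicCube.isNested_box.le_or_le (Finset.mem_filter.1 ha).2
        (Finset.mem_filter.1 hc).2) (fun F => (b F : ℝ≥0∞)) two_pos
    rw [e1, mul_pow, ← ENNReal.rpow_two (∑ F ∈ T, (b F : ℝ≥0∞))]
    refine (mul_le_mul_left h1 _).trans ?_
    rw [Finset.sum_mul, Finset.sum_filter]
    refine Finset.sum_le_sum fun F _ => ?_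
    by_cases h : z ∈ F.box <;> simp [h, hB]
  calc ∫⁻ x, ell2Norm (fun z => ∑ F ∈ S, b F * F.box.indicator μ z) x ^ p' ∂σ
      ≤ ∫⁻ x, ∑ F ∈ S, B F ^ p' * ell2Norm (F.box.indicator μ) x ^ p' ∂σ := by
        refine lintegral_mono fun x => ?_
        rw [ell2Norm_rpow]
        have h2 : ∑' k : ℤ, ‖∑ F ∈ S, b F * F.box.indicator μ (x, twoPow (-k))‖ₑ ^ 2 ≤
            ∑ F ∈ S, B F ^ (2 : ℝ) * ell2Norm (F.box.indicator μ) x ^ (2 : ℝ) := by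
          refine (ENNReal.tsum_le_tsum fun k => hpt (x, twoPow (-k))).trans (le_of_eq ?_)
          rw [Summable.tsum_finsetSum fun _ _ => ENNReal.summable]
          refine Finset.sum_congr rfl fun F _ => ?_
          rw [ell2Norm_sq, ENNReal.tsum_mul_left]
          simp
        refine (ENNReal.rpow_le_rpow h2 (by positivity)).trans
          ((finset_rpow_sum_le _ _ (by positivity) (by linarith)).trans (le_of_eq ?_))
        refine Finset.sum_congr rfl fun F _ => ?_
        rw [← ENNReal.mul_rpow_of_nonneg _ _ two_pos.le, ← ENNReal.rpow_mul,
          ENNReal.mul_rpow_of_nonneg _ _ (by positivity), mul_div_cancel₀ _ two_ne_zero]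
    _ = ∑ F ∈ S, B F ^ p' * boxMass p' σ μ F := by
        have hm (F : DyadicCube n) :
            AEMeasurable (fun x => ell2Norm (F.box.indicator μ) x ^ p') σ :=
          (aemeasurable_ell2Norm (aemeasurable_indicator_box hμ F)).pow_const _
        rw [lintegral_finsetSum' _ fun F _ => (hm F).const_mul _]
        exact Finset.sum_congr rfl fun F _ => lintegral_const_mul'' _ (hm F)

theorem setLIntegral_box_eq (f : HalfSpace n → ℝ≥0) (Q : DyadicCube n) :
    ∫⁻ z in Q.box, (f z : ℝ≥0∞) * (μ z : ℝ≥0∞) ∂(σ.prod eta) =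
      ∫⁻ z, (f z : ℝ≥0∞) * ((Q.box.indicator μ z : ℝ≥0) : ℝ≥0∞) ∂(σ.prod eta) := by
  rw [← lintegral_indicator Q.measurableSet_box]
  refine lintegral_congr fun z => ?_
  by_cases h : z ∈ Q.box <;> simp [h]

theorem setLIntegral_box_lt_top [SFinite σ] (hμ : AEMeasurable μ (σ.prod eta)) {p p' : ℝ}
    (hpp' : p.HolderConjugate p') {f : HalfSpace n → ℝ≥0} (hf : AEMeasurable f (σ.prod eta))
    (hfn : mixedNorm p σ f ≠ ∞) {Q : DyadicCube n}
    (hQ : mixedNorm p' σ (Q.box.indicator μ) ≠ ∞) :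
    ∫⁻ z in Q.box, (f z : ℝ≥0∞) * (μ z : ℝ≥0∞) ∂(σ.prod eta) < ∞ := by
  rw [setLIntegral_box_eq]
  exact (lintegral_mul_le_mixedNorm hpp' hf (aemeasurable_indicator_box hμ Q)).trans_lt
    (ENNReal.mul_lt_top hfn.lt_top hQ.lt_top)

/-- The Carleson embedding for the averages of `f` relative to the box masses. -/
theorem carleson_mixed [SFinite σ] (hμ : AEMeasurable μ (σ.prod eta)) {p p' : ℝ}
    (hpp' : p.HolderConjugate p') (hp2 : p' ≤ 2) {f : HalfSpace n → ℝ≥0}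
    (hf : AEMeasurable f (σ.prod eta)) (hfn : mixedNorm p σ f ≤ 1) {S : Finset (DyadicCube n)}
    (hm0 : ∀ F ∈ S, boxMass p' σ μ F ≠ 0)
    (hm : ∀ Q : DyadicCube n, mixedNorm p' σ (Q.box.indicator μ) < ∞) {θ : ℝ≥0∞} (hθ : θ < 1)
    (hch : ∀ R ∈ S, ∑ F ∈ children S R, boxMass p' σ μ F ≤ θ * boxMass p' σ μ R) :
    ∑ F ∈ S, ((∫⁻ z in F.box, (f z : ℝ≥0∞) * (μ z : ℝ≥0∞) ∂(σ.prod eta)) / boxMass p' σ μ F) ^ p *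
      boxMass p' σ μ F ≤ treeConst θ p' ^ (p - 1) := by
  have hmass (Q) := (boxMass_lt_top hpp'.symm.pos (hm Q)).ne
  refine sum_average_rpow_le hpp' hm0 (fun F _ => hmass F)
    (fun F _ => (setLIntegral_box_lt_top hμ hpp' hf (ne_top_of_le_ne_top ENNReal.one_ne_top hfn)
      (hm F).ne).ne) fun b hb => ?_
  have hind (F : DyadicCube n) := aemeasurable_indicator_box hμ F
  set h : HalfSpace n → ℝ≥0 := fun z => ∑ F ∈ S, (b F).toNNReal * F.box.indicator μ z with hh
  have hhm : AEMeasurable h (σ.prod eta) :=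
    Finset.aemeasurable_fun_sum _ fun F _ => (hind F).const_mul _
  calc ∑ F ∈ S, b F * ∫⁻ z in F.box, (f z : ℝ≥0∞) * (μ z : ℝ≥0∞) ∂(σ.prod eta)
      = ∫⁻ z, (f z : ℝ≥0∞) * (h z : ℝ≥0∞) ∂(σ.prod eta) := by
        have hm1 (F : DyadicCube n) : AEMeasurable (fun z => (f z : ℝ≥0∞) *
            ((F.box.indicator μ z : ℝ≥0) : ℝ≥0∞)) (σ.prod eta) :=
          hf.coe_nnreal_ennreal.mul (hind F).coe_nnreal_ennreal
        simp_rw [setLIntegral_box_eq, ← lintegral_const_mul'' _ (hm1 _)]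
        rw [← lintegral_finsetSum' _ fun F _ => (hm1 F).const_mul _]
        refine lintegral_congr fun z => ?_
        simp only [hh]
        push_cast
        rw [Finset.mul_sum]
        refine Finset.sum_congr rfl fun F hF => ?_
        rw [ENNReal.coe_toNNReal (hb F hF)]
        ring
    _ ≤ mixedNorm p σ f * mixedNorm p' σ h := lintegral_mul_le_mixedNorm hpp' hf hhm
    _ ≤ mixedNorm p' σ h := mul_le_of_le_one_left zero_le hfn
    _ ≤ _ := mixedNorm_sum_indicator_le hμ hpp'.symm.pos hp2 S _
    _ ≤ _ := by
        have h1p : 0 ≤ 1 / p' := by have := hpp'.symm.pos; positivity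
        refine ENNReal.rpow_le_rpow ((sum_ancestorSum_rpow_le DyadicCube.isForest
          (fun F _ => hmass F) (fun F _ => ENNReal.coe_ne_top) hθ hch
          hpp'.symm.lt.le).trans_eq ?_) h1p
        congr 1
        exact Finset.sum_congr rfl fun F hF => by rw [ENNReal.coe_toNNReal (hb F hF)]

theorem lintegral_mul_le_eLpNorm_mul {p p' : ℝ} (hpp' : p.HolderConjugate p')
    {g : (Fin n → ℝ) → ℝ≥0} (hg : Measurable g) {h : (Fin n → ℝ) → ℝ≥0∞} (hh : Measurable h) :
    ∫⁻ x, (g x : ℝ≥0∞) * h x ∂ω ≤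
      eLpNorm g (ENNReal.ofReal p') ω * (∫⁻ x, h x ^ p ∂ω) ^ (1 / p) := by
  rw [eLpNorm_eq hpp'.symm.pos]
  exact ENNReal.lintegral_mul_le_Lp_mul_Lq ω hpp'.symm hg.coe_nnreal_ennreal.aemeasurable
    hh.aemeasurable

theorem setLIntegral_toSet_lt_top {p p' : ℝ} (hpp' : p.HolderConjugate p') {g : (Fin n → ℝ) → ℝ≥0}
    (hg : Measurable g) (hgn : eLpNorm g (ENNReal.ofReal p') ω ≠ ∞) {Q : DyadicCube n}
    (hQ : ω Q.toSet ≠ ∞) : ∫⁻ x in Q.toSet, (g x : ℝ≥0∞) ∂ω < ∞ := by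
  have h1 := lintegral_mul_le_eLpNorm_mul (ω := ω.restrict Q.toSet) hpp' hg
    (h := fun _ => 1) measurable_const
  simp only [mul_one, ENNReal.one_rpow, lintegral_const, Measure.restrict_apply MeasurableSet.univ,
    Set.univ_inter, one_mul] at h1
  have h2 : eLpNorm g (ENNReal.ofReal p') (ω.restrict Q.toSet) < ∞ := by
    have hp' := hpp'.symm.pos
    rw [eLpNorm_eq hp'] at hgn ⊢
    exact (ENNReal.rpow_le_rpow (lintegral_mono' Measure.restrict_le_self le_rfl)
      (by positivity)).trans_lt hgn.lt_top
  refine h1.trans_lt (ENNReal.mul_lt_top h2 ?_)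
  exact ENNReal.rpow_lt_top_of_nonneg (by have := hpp'.pos; positivity) hQ

/-- The Carleson embedding for the averages of `g` relative to `ω`. -/
theorem carleson_scalar {p p' : ℝ} (hpp' : p.HolderConjugate p') {g : (Fin n → ℝ) → ℝ≥0}
    (hg : Measurable g) (hgn : eLpNorm g (ENNReal.ofReal p') ω ≤ 1) {S : Finset (DyadicCube n)}
    (hm0 : ∀ F ∈ S, ω F.toSet ≠ 0) (hm : ∀ Q : DyadicCube n, ω Q.toSet < ∞) {θ : ℝ≥0∞} (hθ : θ < 1)
    (hch : ∀ R ∈ S, ∑ F ∈ children S R, ω F.toSet ≤ θ * ω R.toSet) :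
    ∑ F ∈ S, ((∫⁻ x in F.toSet, (g x : ℝ≥0∞) ∂ω) / ω F.toSet) ^ p' * ω F.toSet ≤
      treeConst θ p ^ (p' - 1) := by
  classical
  have hp := hpp'.pos
  refine sum_average_rpow_le hpp'.symm hm0 (fun F _ => (hm F).ne)
    (fun F _ => (setLIntegral_toSet_lt_top hpp' hg (ne_top_of_le_ne_top ENNReal.one_ne_top hgn)
      (hm F).ne).ne) fun b hb => ?_
  set h : (Fin n → ℝ) → ℝ≥0∞ := fun x => ∑ F ∈ S, F.toSet.indicator (fun _ => b F) x with hh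
  have hhm : Measurable h :=
    Finset.measurable_fun_sum _ fun F _ => measurable_const.indicator F.measurableSet_toSet
  calc ∑ F ∈ S, b F * ∫⁻ x in F.toSet, (g x : ℝ≥0∞) ∂ω
      = ∫⁻ x, (g x : ℝ≥0∞) * h x ∂ω := by
        simp only [hh, Finset.mul_sum]
        have hm1 (F : DyadicCube n) :
            Measurable fun x => (g x : ℝ≥0∞) * F.toSet.indicator (fun _ => b F) x :=
          hg.coe_nnreal_ennreal.mul (measurable_const.indicator F.measurableSet_toSet)
        rw [lintegral_finsetSum _ fun F _ => hm1 F]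
        refine Finset.sum_congr rfl fun F _ => ?_
        rw [← lintegral_indicator F.measurableSet_toSet, ← lintegral_const_mul _
          (hg.coe_nnreal_ennreal.indicator F.measurableSet_toSet)]
        refine lintegral_congr fun x => ?_
        by_cases hx : x ∈ F.toSet <;> simp [hx, mul_comm]
    _ ≤ eLpNorm g (ENNReal.ofReal p') ω * (∫⁻ x, h x ^ p ∂ω) ^ (1 / p) :=
        lintegral_mul_le_eLpNorm_mul hpp' hg hhm
    _ ≤ (∫⁻ x, h x ^ p ∂ω) ^ (1 / p) := mul_le_of_le_one_left zero_le hgn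
    _ ≤ (∑ F ∈ S, ancestorSum S b F ^ p * ω F.toSet) ^ (1 / p) := by
        refine ENNReal.rpow_le_rpow ?_ (by positivity)
        calc ∫⁻ x, h x ^ p ∂ω
            ≤ ∫⁻ x, ∑ F ∈ S, F.toSet.indicator (fun _ => ancestorSum S b F ^ p) x ∂ω := by
              refine lintegral_mono fun x => ?_
              have h1 := sum_rpow_le_sum_ancestorSum_rpow
                (Finset.filter_subset (x ∈ ·.toSet) S)
                (fun a ha c hc => DyadicCube.isNested_toSet.le_or_le (Finset.mem_filter.1 ha).2
                  (Finset.mem_filter.1 hc).2) b hp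
              simp only [Finset.sum_filter] at h1
              simpa [hh, Set.indicator_apply] using h1
          _ = ∑ F ∈ S, ancestorSum S b F ^ p * ω F.toSet := by
              rw [lintegral_finsetSum _ fun F _ => measurable_const.indicator F.measurableSet_toSet]
              refine Finset.sum_congr rfl fun F _ => ?_
              rw [lintegral_indicator F.measurableSet_toSet, lintegral_const,
                Measure.restrict_apply MeasurableSet.univ, Set.univ_inter]
    _ ≤ _ := ENNReal.rpow_le_rpow (sum_ancestorSum_rpow_le DyadicCube.isForest
          (fun F _ => (hm F).ne) hb hθ hch hpp'.lt.le) (by positivity)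

end Carleson

/-! ### The two halves of the form -/

section Halves

variable {n : ℕ} {σ ω : Measure (Fin n → ℝ)} {μ : HalfSpace n → ℝ≥0} {lam : DyadicCube n → ℝ≥0}

theorem sum_formTerm_le_localForm {f : HalfSpace n → ℝ≥0} {g : (Fin n → ℝ) → ℝ≥0}
    {Q₀ : DyadicCube n} {t : Finset (DyadicCube n)} (ht : ∀ Q ∈ t, Q ≤ Q₀) :
    ∑ Q ∈ t, formTerm σ ω μ lam f g Q ≤ localForm σ ω μ lam Q₀ f g := by
  classical
  rw [← Finset.sum_subtype_of_mem (p := fun Q => Q.toSet ⊆ Q₀.toSet) _ fun Q hQ => (ht Q hQ).2]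
  exact ENNReal.sum_le_tsum _

/-- The half of the form in which the averages of `f` dominate those of `g`. The stopping family is
adapted to `f`, relative to the measures `φ_R μ`. On the stopping children `g` may be replaced by
its averages, whose contribution is dominated by the Carleson sum for `f`. -/
theorem sum_formTerm_le_of_testing [SFinite σ] (hμ : AEMeasurable μ (σ.prod eta)) {p p' : ℝ}
    (hpp' : p.HolderConjugate p') (hp2 : p' ≤ 2)
    (hm : ∀ Q : DyadicCube n, mixedNorm p' σ (Q.box.indicator μ) < ∞)
    (hω : ∀ Q : DyadicCube n, ω Q.toSet < ∞) {T : ℝ≥0∞} (hT : TestingBound σ ω μ lam p p' T)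
    {f : HalfSpace n → ℝ≥0} (hf : AEMeasurable f (σ.prod eta)) (hfn : mixedNorm p σ f ≤ 1)
    {g : (Fin n → ℝ) → ℝ≥0} (hg : Measurable g) (hgn : eLpNorm g (ENNReal.ofReal p') ω ≤ 1)
    {s : Finset (DyadicCube n)} (hs0 : ∀ Q ∈ s, boxMass p' σ μ Q ≠ 0)
    (hs1 : ∀ Q ∈ s, ω Q.toSet ≠ 0)
    (hcmp : ∀ Q ∈ s, ((∫⁻ x in Q.toSet, (g x : ℝ≥0∞) ∂ω) / ω Q.toSet) ^ p' * ω Q.toSet ≤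
      ((∫⁻ z in Q.box, (f z : ℝ≥0∞) * (μ z : ℝ≥0∞) ∂(σ.prod eta)) / boxMass p' σ μ Q) ^ p *
        boxMass p' σ μ Q) :
    ∑ Q ∈ s, formTerm σ ω μ lam f g Q ≤
      2 * (treeConst (2 ^ (-(p' / 2))) p' ^ (p - 1)) ^ (1 / p) *
        (1 + (treeConst (2 ^ (-(p' / 2))) p' ^ (p - 1)) ^ (1 / p')) * T := by
  classical
  have hp0 := hpp'.pos
  have hp0' := hpp'.symm.pos
  have hmass (Q : DyadicCube n) : boxMass p' σ μ Q ≠ ∞ := (boxMass_lt_top hp0' (hm Q)).ne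
  set A : DyadicCube n → ℝ≥0∞ := fun Q =>
    ∫⁻ z in Q.box, (f z : ℝ≥0∞) * (μ z : ℝ≥0∞) ∂(σ.prod eta) with hA
  set G : DyadicCube n → ℝ≥0∞ := fun Q => ∫⁻ x in Q.toSet, (g x : ℝ≥0∞) ∂ω with hG
  set M := boxMass p' σ μ with hM
  have hAtop (Q : DyadicCube n) : A Q ≠ ∞ :=
    (setLIntegral_box_lt_top hμ hpp' hf (ne_top_of_le_ne_top ENNReal.one_ne_top hfn) (hm Q).ne).ne
  have hGtop (Q : DyadicCube n) : G Q ≠ ∞ :=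
    (setLIntegral_toSet_lt_top hpp' hg (ne_top_of_le_ne_top ENNReal.one_ne_top hgn) (hω Q).ne).ne
  obtain ⟨S, hSs, hS⟩ := exists_stopping
    (fun R Q => 2 * (A R / M R) * testMass p' σ μ R Q < A Q) s
  have hch : ∀ R ∈ S, ∑ F ∈ children S R, M F ≤ 2 ^ (-(p' / 2)) * M R := by
    intro R hR
    refine sum_boxMass_le hμ hp0' hp2 (hmass R) (fun F hF => (mem_children.1 hF).2.1.le)
      (fun F hF F' hF' => eq_of_le_of_mem_children hF hF') ?_
    refine two_mul_sum_le (hs0 R (hSs hR)) (hmass R) (hAtop R)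
      (sum_children_setLIntegral_le (σ.prod eta) DyadicCube.isNested_box
        DyadicCube.measurableSet_box R _) fun F hF => ?_
    have hF' := mem_children.1 hF
    exact (hS F (hSs hF'.1)).1 hF'.1 R hR hF'.2.1 hF'.2.2
  have hθ : (2 : ℝ≥0∞) ^ (-(p' / 2)) < 1 :=
    ENNReal.rpow_lt_one_of_one_lt_of_neg (by norm_num) (by linarith)
  have hX := carleson_mixed hμ hpp' hp2 hf hfn (fun F hF => hs0 F (hSs hF)) hm hθ hch
  set X := treeConst (2 ^ (-(p' / 2))) p' ^ (p - 1) with hXdef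
  let gE : DyadicCube n → (Fin n → ℝ) → ℝ≥0 := fun F =>
    (leastSet S DyadicCube.toSet F).indicator g
  let gC : DyadicCube n → (Fin n → ℝ) → ℝ≥0 := fun F x =>
    ∑ F' ∈ children S F, F'.toSet.indicator (fun _ => (G F' / ω F'.toSet).toNNReal) x
  have hgEm (F : DyadicCube n) : Measurable (gE F) :=
    hg.indicator (measurableSet_leastSet DyadicCube.measurableSet_toSet S F)
  have hgCm (F : DyadicCube n) : Measurable (gC F) :=
    Finset.measurable_fun_sum _ fun F' _ => measurable_const.indicator F'.measurableSet_toSet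
  have hd : ∀ F ∈ S, (((G F / ω F.toSet).toNNReal : ℝ≥0) : ℝ≥0∞) = G F / ω F.toSet := fun F hF =>
    ENNReal.coe_toNNReal (ENNReal.div_ne_top (hGtop F) (hs1 F (hSs hF)))
  have htest (F : DyadicCube n) {h : (Fin n → ℝ) → ℝ≥0} (hh : Measurable h)
      {t : Finset (DyadicCube n)} (ht : ∀ Q ∈ t, Q ≤ F) :
      ∑ Q ∈ t, (lam Q : ℝ≥0∞) * testMass p' σ μ F Q * ∫⁻ x in Q.toSet, (h x : ℝ≥0∞) ∂ω ≤
        T * M F ^ (1 / p) * eLpNorm h (ENNReal.ofReal p') ω := by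
    rw [hM, ← mixedNorm_testFun hμ hpp' (hmass F)]
    exact (sum_formTerm_le_localForm ht).trans (hT F h hh)
  refine stopping_sum_le (m := M) (ν := testMass p' σ μ) (T := T) hpp'
    (HE := fun F Q => ∫⁻ x in Q.toSet, (gE F x : ℝ≥0∞) ∂ω)
    (HC := fun F Q => ∫⁻ x in Q.toSet, (gC F x : ℝ≥0∞) ∂ω)
    (N := fun F => eLpNorm (gE F) (ENNReal.ofReal p') ω)
    (R := fun F => eLpNorm (gC F) (ENNReal.ofReal p') ω)
    (fun Q hQ => ?_) hX (fun F _ t _ ht => htest F (hgEm F) ht)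
    (fun F _ t _ ht => htest F (hgCm F) ht) ?_ ?_
  · obtain ⟨F, hF, hQF, hmin, hb⟩ := exists_stopping_parent hS hQ
    refine ⟨F, hF, hQF, ?_, ?_⟩
    · rcases hb with rfl | hb
      · rw [testMass_self hμ hp0' (hmass F), mul_assoc, ENNReal.div_mul_cancel (hs0 F hQ) (hmass F)]
        exact le_mul_of_one_le_left zero_le one_le_two
      · exact not_lt.1 hb
    · have h1 := setLIntegral_le_leastSet_add ω DyadicCube.isForest DyadicCube.isNested_toSet
        DyadicCube.measurableSet_toSet hQF hmin (fun x => (g x : ℝ≥0∞))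
        (fun x => (gC F x : ℝ≥0∞)) fun F' hF' _ => ?_
      · simpa only [gE, ENNReal.coe_indicator] using h1
      · have hF'S := children_subset hF'
        calc G F' = ∫⁻ x in F'.toSet, G F' / ω F'.toSet ∂ω := by
              rw [lintegral_const, Measure.restrict_apply MeasurableSet.univ, Set.univ_inter,
                ENNReal.div_mul_cancel (hs1 F' (hSs hF'S)) (hω F').ne]
          _ ≤ _ := by
              refine setLIntegral_mono' F'.measurableSet_toSet fun x hx => ?_
              rw [← hd F' hF'S, ENNReal.coe_le_coe]
              refine le_trans (le_of_eq ?_) (Finset.single_le_sum (fun _ _ => zero_le) hF')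
              rw [Set.indicator_of_mem hx]
  · simp_rw [eLpNorm_rpow hp0', enorm_NNReal]
    rw [← lintegral_finsetSum _ fun F _ => (hgEm F).coe_nnreal_ennreal.pow_const _]
    calc _ ≤ ∫⁻ x, (g x : ℝ≥0∞) ^ p' ∂ω := by
          refine lintegral_mono fun x => le_trans (le_of_eq ?_)
            (sum_indicator_leastSet_le (S := S) (U := DyadicCube.toSet)
              (fun x => (g x : ℝ≥0∞) ^ p') x)
          refine Finset.sum_congr rfl fun F _ => ?_
          by_cases hx : x ∈ leastSet S DyadicCube.toSet F <;> simp [gE, hx, hp0']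
      _ = eLpNorm g (ENNReal.ofReal p') ω ^ p' := by rw [eLpNorm_rpow hp0']; rfl
      _ ≤ 1 := ENNReal.rpow_le_one hgn hp0'.le
  · refine le_trans (Finset.sum_le_sum fun F _ => ?_) (sum_children_le.trans hX)
    refine le_trans ?_ (Finset.sum_le_sum fun F' hF' => hcmp F' (hSs (children_subset hF')))
    rw [eLpNorm_rpow hp0']
    calc ∫⁻ x, ‖gC F x‖ₑ ^ p' ∂ω ≤ ∫⁻ x, ∑ F' ∈ children S F,
          F'.toSet.indicator (fun _ => (G F' / ω F'.toSet) ^ p') x ∂ω := by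
          refine lintegral_mono fun x => ?_
          simp only [enorm_NNReal, gC]
          by_cases hex : ∃ F' ∈ children S F, x ∈ F'.toSet
          · obtain ⟨F', hF', hx⟩ := hex
            rw [Finset.sum_eq_single_of_mem F' hF']
            · refine le_trans (le_of_eq ?_) (Finset.single_le_sum (fun _ _ => zero_le) hF')
              rw [Set.indicator_of_mem hx, Set.indicator_of_mem hx, hd F' (children_subset hF')]
            · exact fun F'' hF'' hne => Set.indicator_of_notMem (fun hx' => hne
                (eq_of_mem_children_of_mem DyadicCube.isNested_toSet hF'' hF' hx' hx)) _
          · push Not at hex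
            rw [Finset.sum_eq_zero fun F' hF' => Set.indicator_of_notMem (hex F' hF') _]
            simp [hp0']
      _ = _ := by
          rw [lintegral_finsetSum _ fun F' _ => measurable_const.indicator F'.measurableSet_toSet]
          refine Finset.sum_congr rfl fun F' _ => ?_
          rw [lintegral_indicator F'.measurableSet_toSet, lintegral_const,
            Measure.restrict_apply MeasurableSet.univ, Set.univ_inter]

/-- The half of the form in which the averages of `g` dominate those of `f`. The stopping family is
adapted to `g`, relative to `ω`. On the boxes over the stopping children `f` may be replaced by
multiples of the test functions; off them, `2 ≤ p` gives the superadditivity of the `p`-th powers of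
the mixed norms of functions with disjoint supports. -/
theorem sum_formTerm_le_of_dualTesting [SFinite σ] (hμ : AEMeasurable μ (σ.prod eta)) {p p' : ℝ}
    (hp2 : 2 ≤ p) (hpp' : p.HolderConjugate p')
    (hm : ∀ Q : DyadicCube n, mixedNorm p' σ (Q.box.indicator μ) < ∞)
    (hω : ∀ Q : DyadicCube n, ω Q.toSet < ∞) {T : ℝ≥0∞} (hT : DualTestingBound σ ω μ lam p p' T)
    {f : HalfSpace n → ℝ≥0} (hf : AEMeasurable f (σ.prod eta)) (hfn : mixedNorm p σ f ≤ 1)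
    {g : (Fin n → ℝ) → ℝ≥0} (hg : Measurable g) (hgn : eLpNorm g (ENNReal.ofReal p') ω ≤ 1)
    {s : Finset (DyadicCube n)} (hs0 : ∀ Q ∈ s, boxMass p' σ μ Q ≠ 0)
    (hs1 : ∀ Q ∈ s, ω Q.toSet ≠ 0)
    (hcmp : ∀ Q ∈ s,
      ((∫⁻ z in Q.box, (f z : ℝ≥0∞) * (μ z : ℝ≥0∞) ∂(σ.prod eta)) / boxMass p' σ μ Q) ^ p *
        boxMass p' σ μ Q ≤
      ((∫⁻ x in Q.toSet, (g x : ℝ≥0∞) ∂ω) / ω Q.toSet) ^ p' * ω Q.toSet) :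
    ∑ Q ∈ s, formTerm σ ω μ lam f g Q ≤
      2 * (treeConst 2⁻¹ p ^ (p' - 1)) ^ (1 / p') *
        (1 + (treeConst 2⁻¹ p ^ (p' - 1)) ^ (1 / p)) * T := by
  classical
  have hp0 := hpp'.pos
  have hp0' := hpp'.symm.pos
  have hmass (Q : DyadicCube n) : boxMass p' σ μ Q ≠ ∞ := (boxMass_lt_top hp0' (hm Q)).ne
  set A : DyadicCube n → ℝ≥0∞ := fun Q =>
    ∫⁻ z in Q.box, (f z : ℝ≥0∞) * (μ z : ℝ≥0∞) ∂(σ.prod eta) with hA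
  set G : DyadicCube n → ℝ≥0∞ := fun Q => ∫⁻ x in Q.toSet, (g x : ℝ≥0∞) ∂ω with hG
  set M := boxMass p' σ μ with hM
  have hAtop (Q : DyadicCube n) : A Q ≠ ∞ :=
    (setLIntegral_box_lt_top hμ hpp' hf (ne_top_of_le_ne_top ENNReal.one_ne_top hfn) (hm Q).ne).ne
  have hGtop (Q : DyadicCube n) : G Q ≠ ∞ :=
    (setLIntegral_toSet_lt_top hpp' hg (ne_top_of_le_ne_top ENNReal.one_ne_top hgn) (hω Q).ne).ne
  obtain ⟨S, hSs, hS⟩ := exists_stopping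
    (fun R Q => 2 * (G R / ω R.toSet) * ω Q.toSet < G Q) s
  have hch : ∀ R ∈ S, ∑ F ∈ children S R, ω F.toSet ≤ 2⁻¹ * ω R.toSet := by
    intro R hR
    have h2 : 2 * ∑ F ∈ children S R, ω F.toSet ≤ ω R.toSet := by
      refine two_mul_sum_le (hs1 R (hSs hR)) (hω R).ne (hGtop R)
        (sum_children_setLIntegral_le ω DyadicCube.isNested_toSet
          DyadicCube.measurableSet_toSet R _) fun F hF => ?_
      have hF' := mem_children.1 hF
      exact (hS F (hSs hF'.1)).1 hF'.1 R hR hF'.2.1 hF'.2.2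
    calc ∑ F ∈ children S R, ω F.toSet = 2⁻¹ * (2 * ∑ F ∈ children S R, ω F.toSet) := by
          rw [← mul_assoc, ENNReal.inv_mul_cancel two_ne_zero (by simp), one_mul]
      _ ≤ _ := by gcongr
  have hX := carleson_scalar hpp' hg hgn (fun F hF => hs1 F (hSs hF)) hω
    (ENNReal.inv_lt_one.2 (by norm_num)) hch
  set X := treeConst 2⁻¹ p ^ (p' - 1) with hXdef
  let fE : DyadicCube n → HalfSpace n → ℝ≥0 := fun F =>
    (leastSet S DyadicCube.box F).indicator f
  let fC : DyadicCube n → HalfSpace n → ℝ≥0 := fun F z =>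
    ∑ F' ∈ children S F, (A F' / M F').toNNReal * testFun μ p' F' z
  have hfEm (F : DyadicCube n) : AEMeasurable (fE F) (σ.prod eta) :=
    hf.indicator (measurableSet_leastSet DyadicCube.measurableSet_box S F)
  have hφm (F : DyadicCube n) := aemeasurable_testFun hμ p' F
  have hfCm (F : DyadicCube n) : AEMeasurable (fC F) (σ.prod eta) :=
    Finset.aemeasurable_fun_sum _ fun F' _ => (hφm F').const_mul _
  have hc : ∀ F ∈ S, (((A F / M F).toNNReal : ℝ≥0) : ℝ≥0∞) = A F / M F := fun F hF =>
    ENNReal.coe_toNNReal (ENNReal.div_ne_top (hAtop F) (hs0 F (hSs hF)))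
  have htest (F : DyadicCube n) {h : HalfSpace n → ℝ≥0} (hh : AEMeasurable h (σ.prod eta))
      {t : Finset (DyadicCube n)} (ht : ∀ Q ∈ t, Q ≤ F) :
      ∑ Q ∈ t, (lam Q : ℝ≥0∞) * ω Q.toSet *
        ∫⁻ z in Q.box, (h z : ℝ≥0∞) * (μ z : ℝ≥0∞) ∂(σ.prod eta) ≤
        T * ω F.toSet ^ (1 / p') * mixedNorm p σ h := by
    have h1 : eLpNorm (F.toSet.indicator (1 : (Fin n → ℝ) → ℝ≥0)) (ENNReal.ofReal p') ω =
        ω F.toSet ^ (1 / p') := by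
      rw [eLpNorm_eq hp0']
      congr 1
      calc ∫⁻ x, ‖F.toSet.indicator (1 : (Fin n → ℝ) → ℝ≥0) x‖ₑ ^ p' ∂ω
          = ∫⁻ x, F.toSet.indicator 1 x ∂ω := by
            refine lintegral_congr fun x => ?_
            by_cases hx : x ∈ F.toSet <;> simp [hx, hp0']
        _ = ω F.toSet := lintegral_indicator_one F.measurableSet_toSet
    have h2 : ∑ Q ∈ t, (lam Q : ℝ≥0∞) * ω Q.toSet *
        ∫⁻ z in Q.box, (h z : ℝ≥0∞) * (μ z : ℝ≥0∞) ∂(σ.prod eta) =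
        ∑ Q ∈ t, formTerm σ ω μ lam h (F.toSet.indicator 1) Q := by
      refine Finset.sum_congr rfl fun Q hQ => ?_
      have h3 : ∫⁻ x in Q.toSet, ((F.toSet.indicator (1 : (Fin n → ℝ) → ℝ≥0) x : ℝ≥0) : ℝ≥0∞) ∂ω =
          ω Q.toSet := by
        rw [setLIntegral_congr_fun (g := fun _ => 1) Q.measurableSet_toSet fun x hx => by
          simp [(ht Q hQ).2 hx], setLIntegral_one]
      rw [formTerm, h3]
      ring
    rw [h2, mul_right_comm, ← h1]
    exact (sum_formTerm_le_localForm ht).trans (hT F h hh)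
  have hterm : ∀ Q, formTerm σ ω μ lam f g Q = lam Q * G Q * A Q := fun Q => by
    simp only [formTerm, hA, hG]
    ring
  simp_rw [hterm]
  refine stopping_sum_le (m := fun F => ω F.toSet) (ν := fun _ Q => ω Q.toSet) (T := T) hpp'.symm
    (HE := fun F Q => ∫⁻ z in Q.box, (fE F z : ℝ≥0∞) * (μ z : ℝ≥0∞) ∂(σ.prod eta))
    (HC := fun F Q => ∫⁻ z in Q.box, (fC F z : ℝ≥0∞) * (μ z : ℝ≥0∞) ∂(σ.prod eta))
    (N := fun F => mixedNorm p σ (fE F)) (R := fun F => mixedNorm p σ (fC F))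
    (fun Q hQ => ?_) hX (fun F _ t _ ht => htest F (hfEm F) ht)
    (fun F _ t _ ht => htest F (hfCm F) ht) ?_ ?_
  · obtain ⟨F, hF, hQF, hmin, hb⟩ := exists_stopping_parent hS hQ
    refine ⟨F, hF, hQF, ?_, ?_⟩
    · rcases hb with rfl | hb
      · rw [mul_assoc, ENNReal.div_mul_cancel (hs1 F hQ) (hω F).ne]
        exact le_mul_of_one_le_left zero_le one_le_two
      · exact not_lt.1 hb
    · have h1 := setLIntegral_le_leastSet_add (σ.prod eta) DyadicCube.isForest
        DyadicCube.isNested_box DyadicCube.measurableSet_box hQF hmin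
        (fun z => (f z : ℝ≥0∞) * (μ z : ℝ≥0∞))
        (fun z => (fC F z : ℝ≥0∞) * (μ z : ℝ≥0∞)) fun F' hF' _ => ?_
      · refine h1.trans (add_le_add_left (le_of_eq ?_) _)
        refine lintegral_congr fun z => ?_
        by_cases hz : z ∈ leastSet S DyadicCube.box F <;> simp [fE, hz]
      · have hF'S := children_subset hF'
        calc A F' = A F' / M F' * testMass p' σ μ F' F' := by
              rw [testMass_self hμ hp0' (hmass F'),
                ENNReal.div_mul_cancel (hs0 F' (hSs hF'S)) (hmass F')]
          _ = ∫⁻ z in F'.box, A F' / M F' * ((testFun μ p' F' z : ℝ≥0∞) * (μ z : ℝ≥0∞))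
                ∂(σ.prod eta) := by
              rw [testMass, lintegral_const_mul'']
              exact ((hφm F').coe_nnreal_ennreal.mul hμ.coe_nnreal_ennreal).restrict
          _ ≤ _ := by
              refine lintegral_mono fun z => ?_
              rw [← mul_assoc, ← hc F' hF'S]
              gcongr
              rw [← ENNReal.coe_mul, ENNReal.coe_le_coe]
              exact Finset.single_le_sum (f := fun F' => (A F' / M F').toNNReal * testFun μ p' F' z)
                (fun _ _ => zero_le) hF'
  · simp_rw [mixedNorm_rpow hp0]
    rw [← lintegral_finsetSum' _ fun F _ => (aemeasurable_ell2Norm (hfEm F)).pow_const _]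
    calc _ ≤ ∫⁻ x, ell2Norm f x ^ p ∂σ := by
          refine lintegral_mono fun x => ?_
          simp_rw [ell2Norm_rpow]
          refine (finset_sum_rpow_le _ _ (by linarith)).trans ?_
          gcongr
          rw [← Summable.tsum_finsetSum fun _ _ => ENNReal.summable]
          refine ENNReal.tsum_le_tsum fun k => le_trans (le_of_eq ?_)
            (sum_indicator_leastSet_le (S := S) (U := DyadicCube.box)
              (fun z => ‖f z‖ₑ ^ 2) (x, twoPow (-k)))
          refine Finset.sum_congr rfl fun F _ => ?_
          by_cases hx : (x, twoPow (-k)) ∈ leastSet S DyadicCube.box F <;> simp [fE, hx]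
      _ = mixedNorm p σ f ^ p := (mixedNorm_rpow hp0 f).symm
      _ ≤ 1 := ENNReal.rpow_le_one hfn hp0.le
  · refine le_trans (Finset.sum_le_sum fun F _ => ?_) (sum_children_le.trans hX)
    refine le_trans ?_ (Finset.sum_le_sum fun F' hF' => hcmp F' (hSs (children_subset hF')))
    rw [mixedNorm_rpow hp0]
    have hmem : ∀ F' x t, (A F' / M F').toNNReal * testFun μ p' F' (x, t) ≠ 0 → x ∈ F'.toSet := by
      intro F' x t hne
      by_contra hx
      have : (x, t) ∉ F'.box := fun h => hx h.1
      simp [testFun_eq, this] at hne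
    calc ∫⁻ x, ell2Norm (fC F) x ^ p ∂σ ≤ ∫⁻ x, ∑ F' ∈ children S F,
          ell2Norm (fun z => (A F' / M F').toNNReal * testFun μ p' F' z) x ^ p ∂σ := by
          refine lintegral_mono fun x => ell2Norm_sum_rpow_le hp0 ?_
          exact fun F' hF' F'' hF'' t t' h h' => eq_of_mem_children_of_mem
            DyadicCube.isNested_toSet hF' hF'' (hmem F' x t h) (hmem F'' x t' h')
      _ = ∑ F' ∈ children S F,
          mixedNorm p σ (fun z => (A F' / M F').toNNReal * testFun μ p' F' z) ^ p := by
          rw [lintegral_finsetSum' _ fun F' _ =>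
            (aemeasurable_ell2Norm ((hφm F').const_mul _)).pow_const _]
          simp_rw [mixedNorm_rpow hp0]
      _ = _ := by
          refine Finset.sum_congr rfl fun F' hF' => ?_
          rw [mixedNorm_const_mul hp0, hc F' (children_subset hF'),
            mixedNorm_testFun hμ hpp' (hmass F'), ENNReal.mul_rpow_of_nonneg _ _ hp0.le,
            ← ENNReal.rpow_mul, one_div_mul_cancel hp0.ne',
            ENNReal.rpow_one]

end Halves

/-! ### The form and the testing constants -/

section FormBounds

variable {n : ℕ} {σ ω : Measure (Fin n → ℝ)} {μ : HalfSpace n → ℝ≥0} {lam : DyadicCube n → ℝ≥0}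

/-- The sum of the constants of the two halves of the form. -/
noncomputable def halvesConst (p p' : ℝ) : ℝ≥0∞ :=
  2 * (treeConst (2 ^ (-(p' / 2))) p' ^ (p - 1)) ^ (1 / p) *
      (1 + (treeConst (2 ^ (-(p' / 2))) p' ^ (p - 1)) ^ (1 / p')) +
    2 * (treeConst 2⁻¹ p ^ (p' - 1)) ^ (1 / p') * (1 + (treeConst 2⁻¹ p ^ (p' - 1)) ^ (1 / p))

theorem halvesConst_lt_top {p p' : ℝ} (hpp' : p.HolderConjugate p') : halvesConst p p' < ∞ := by
  have hp := hpp'.pos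
  have hp' := hpp'.symm.pos
  have hp1 := hpp'.lt
  have hp1' := hpp'.symm.lt
  have h1 : treeConst (2 ^ (-(p' / 2))) p' ^ (p - 1) < ∞ :=
    ENNReal.rpow_lt_top_of_nonneg (by linarith) (treeConst_lt_top
      (ENNReal.rpow_lt_one_of_one_lt_of_neg (by norm_num) (by linarith)) hp').ne
  have h2 : treeConst 2⁻¹ p ^ (p' - 1) < ∞ :=
    ENNReal.rpow_lt_top_of_nonneg (by linarith)
      (treeConst_lt_top (ENNReal.inv_lt_one.2 (by norm_num)) hp).ne
  have e (X : ℝ≥0∞) (hX : X < ∞) {a b : ℝ} (ha : 0 < a) (hb : 0 < b) :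
      2 * X ^ (1 / a) * (1 + X ^ (1 / b)) < ∞ :=
    ENNReal.mul_lt_top (ENNReal.mul_lt_top (by simp)
      (ENNReal.rpow_lt_top_of_nonneg (by positivity) hX.ne))
      (ENNReal.add_lt_top.2 ⟨by simp, ENNReal.rpow_lt_top_of_nonneg (by positivity) hX.ne⟩)
  exact ENNReal.add_lt_top.2 ⟨e _ h1 hp hp', e _ h2 hp' hp⟩

theorem setLIntegral_box_le [SFinite σ] (hμ : AEMeasurable μ (σ.prod eta)) {p p' : ℝ}
    (hpp' : p.HolderConjugate p') {f : HalfSpace n → ℝ≥0} (hf : AEMeasurable f (σ.prod eta))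
    (Q : DyadicCube n) : ∫⁻ z in Q.box, (f z : ℝ≥0∞) * (μ z : ℝ≥0∞) ∂(σ.prod eta) ≤
      mixedNorm p σ f * mixedNorm p' σ (Q.box.indicator μ) := by
  rw [setLIntegral_box_eq]
  exact lintegral_mul_le_mixedNorm hpp' hf (aemeasurable_indicator_box hμ Q)

/-- The bound for normalised functions. Following Treil, the cubes are split according to which of
the two averages is larger in the relevant norm, so that each half needs a single stopping
family. -/
theorem form_le_of_norm_le_one [SFinite σ] (hμ : AEMeasurable μ (σ.prod eta)) {p p' : ℝ}
    (hp : 2 ≤ p) (hpp' : p.HolderConjugate p')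
    (hm : ∀ Q : DyadicCube n, mixedNorm p' σ (Q.box.indicator μ) < ∞)
    (hω : ∀ Q : DyadicCube n, ω Q.toSet < ∞) {T : ℝ≥0∞} (hT : TestingBound σ ω μ lam p p' T)
    (hT' : DualTestingBound σ ω μ lam p p' T)
    {f : HalfSpace n → ℝ≥0} (hf : AEMeasurable f (σ.prod eta)) (hfn : mixedNorm p σ f ≤ 1)
    {g : (Fin n → ℝ) → ℝ≥0} (hg : Measurable g) (hgn : eLpNorm g (ENNReal.ofReal p') ω ≤ 1) :
    form σ ω μ lam f g ≤ halvesConst p p' * T := by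
  classical
  have hp2 : p' ≤ 2 := by
    have h1 := hpp'.sub_one_mul_conj
    have h2 := hpp'.symm.pos
    nlinarith
  rw [form, ENNReal.tsum_eq_iSup_sum]
  refine iSup_le fun s => ?_
  have h0 : ∀ Q, ¬(boxMass p' σ μ Q ≠ 0 ∧ ω Q.toSet ≠ 0) → formTerm σ ω μ lam f g Q = 0 := by
    intro Q hQ
    by_cases hM : boxMass p' σ μ Q = 0
    · have h1 := setLIntegral_box_le hμ hpp' hf Q
      have hp'0 := hpp'.symm.pos
      rw [boxMass_eq hp'0, hM, ENNReal.zero_rpow_of_pos (by positivity), mul_zero,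
        nonpos_iff_eq_zero] at h1
      simp [formTerm, h1]
    · have hQ0 : ω Q.toSet = 0 := by
        by_contra h
        exact hQ ⟨hM, h⟩
      simp [formTerm, Measure.restrict_eq_zero.2 hQ0]
  set s' := s.filter fun Q => boxMass p' σ μ Q ≠ 0 ∧ ω Q.toSet ≠ 0 with hs'
  have hss' : ∑ Q ∈ s, formTerm σ ω μ lam f g Q = ∑ Q ∈ s', formTerm σ ω μ lam f g Q := by
    refine (Finset.sum_subset (Finset.filter_subset _ _) fun Q hQ hQ' => h0 Q fun h => hQ' ?_).symm
    exact Finset.mem_filter.2 ⟨hQ, h⟩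
  have hs0 : ∀ Q ∈ s', boxMass p' σ μ Q ≠ 0 := fun Q hQ => (Finset.mem_filter.1 hQ).2.1
  have hs1 : ∀ Q ∈ s', ω Q.toSet ≠ 0 := fun Q hQ => (Finset.mem_filter.1 hQ).2.2
  rw [hss', ← Finset.sum_filter_add_sum_filter_not s' fun Q =>
    ((∫⁻ x in Q.toSet, (g x : ℝ≥0∞) ∂ω) / ω Q.toSet) ^ p' * ω Q.toSet ≤
      ((∫⁻ z in Q.box, (f z : ℝ≥0∞) * (μ z : ℝ≥0∞) ∂(σ.prod eta)) / boxMass p' σ μ Q) ^ p *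
        boxMass p' σ μ Q, halvesConst, add_mul]
  refine add_le_add ?_ ?_
  · exact sum_formTerm_le_of_testing hμ hpp' hp2 hm hω hT hf hfn hg hgn
      (fun Q hQ => hs0 Q (Finset.mem_filter.1 hQ).1) (fun Q hQ => hs1 Q (Finset.mem_filter.1 hQ).1)
      fun Q hQ => (Finset.mem_filter.1 hQ).2
  · exact sum_formTerm_le_of_dualTesting hμ hp hpp' hm hω hT' hf hfn hg hgn
      (fun Q hQ => hs0 Q (Finset.mem_filter.1 hQ).1) (fun Q hQ => hs1 Q (Finset.mem_filter.1 hQ).1)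
      fun Q hQ => (not_le.1 (Finset.mem_filter.1 hQ).2).le

theorem form_mul_mul (a b : ℝ≥0) (f : HalfSpace n → ℝ≥0) (g : (Fin n → ℝ) → ℝ≥0) :
    form σ ω μ lam (fun z => a * f z) (fun x => b * g x) = a * b * form σ ω μ lam f g := by
  rw [form, form, ← ENNReal.tsum_mul_left]
  refine tsum_congr fun Q => ?_
  simp only [formTerm, ENNReal.coe_mul, mul_assoc]
  rw [lintegral_const_mul' _ _ ENNReal.coe_ne_top, lintegral_const_mul' _ _ ENNReal.coe_ne_top]
  ring

theorem eLpNorm_const_mul {p : ℝ} (hp : 0 < p) (c : ℝ≥0) (g : (Fin n → ℝ) → ℝ≥0) :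
    eLpNorm (fun x => c * g x) (ENNReal.ofReal p) ω = c * eLpNorm g (ENNReal.ofReal p) ω := by
  simp_rw [eLpNorm_eq hp, enorm_NNReal, ENNReal.coe_mul, ENNReal.mul_rpow_of_nonneg _ _ hp.le]
  rw [lintegral_const_mul' _ _ (by simp [hp.le]), ENNReal.mul_rpow_of_nonneg _ _ (by positivity),
    ← ENNReal.rpow_mul, mul_one_div_cancel hp.ne', ENNReal.rpow_one]

theorem form_eq_zero_of_mixedNorm_eq_zero [SFinite σ] (hμ : AEMeasurable μ (σ.prod eta)) {p p' : ℝ}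
    (hpp' : p.HolderConjugate p') {f : HalfSpace n → ℝ≥0} (hf : AEMeasurable f (σ.prod eta))
    (h0 : mixedNorm p σ f = 0) (g : (Fin n → ℝ) → ℝ≥0) : form σ ω μ lam f g = 0 := by
  refine ENNReal.tsum_eq_zero.2 fun Q => ?_
  have h1 := setLIntegral_box_le hμ hpp' hf Q
  rw [h0, zero_mul, nonpos_iff_eq_zero] at h1
  simp [formTerm, h1]

theorem form_eq_zero_of_eLpNorm_eq_zero {p' : ℝ} (hp' : 0 < p') (f : HalfSpace n → ℝ≥0)
    {g : (Fin n → ℝ) → ℝ≥0} (hg : Measurable g) (h0 : eLpNorm g (ENNReal.ofReal p') ω = 0) :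
    form σ ω μ lam f g = 0 := by
  refine ENNReal.tsum_eq_zero.2 fun Q => ?_
  have h1 : ∫⁻ x, (g x : ℝ≥0∞) ^ p' ∂ω = 0 := by
    rw [← ENNReal.zero_rpow_of_pos hp', ← h0, eLpNorm_rpow hp']
    rfl
  rw [lintegral_eq_zero_iff (hg.coe_nnreal_ennreal.pow_const _)] at h1
  have h2 : ∫⁻ x in Q.toSet, (g x : ℝ≥0∞) ∂ω = 0 := by
    rw [lintegral_eq_zero_iff hg.coe_nnreal_ennreal]
    refine ae_restrict_of_ae ?_
    filter_upwards [h1] with x hx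
    simpa [hp'] using hx
  simp [formTerm, h2]

/-- A bound for functions of finite norm gives `FormBound` if the constant is positive; the latter
takes care of the functions of infinite norm. -/
theorem formBound_of_finite [SFinite σ] (hμ : AEMeasurable μ (σ.prod eta)) {p p' : ℝ}
    (hpp' : p.HolderConjugate p') {K : ℝ≥0∞} (hK : K ≠ 0)
    (h : ∀ f : HalfSpace n → ℝ≥0, AEMeasurable f (σ.prod eta) → mixedNorm p σ f ≠ 0 →
      mixedNorm p σ f ≠ ∞ → ∀ g : (Fin n → ℝ) → ℝ≥0, Measurable g →
      eLpNorm g (ENNReal.ofReal p') ω ≠ 0 → eLpNorm g (ENNReal.ofReal p') ω ≠ ∞ →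
      form σ ω μ lam f g ≤ K * mixedNorm p σ f * eLpNorm g (ENNReal.ofReal p') ω) :
    FormBound σ ω μ lam p p' K := by
  intro f hf g hg
  by_cases hf0 : mixedNorm p σ f = 0
  · rw [form_eq_zero_of_mixedNorm_eq_zero hμ hpp' hf hf0]
    exact zero_le
  by_cases hg0 : eLpNorm g (ENNReal.ofReal p') ω = 0
  · rw [form_eq_zero_of_eLpNorm_eq_zero hpp'.symm.pos f hg hg0]
    exact zero_le
  by_cases hft : mixedNorm p σ f = ∞
  · rw [hft, ENNReal.mul_top hK, ENNReal.top_mul hg0]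
    exact le_top
  by_cases hgt : eLpNorm g (ENNReal.ofReal p') ω = ∞
  · rw [hgt, ENNReal.mul_top (mul_ne_zero hK hf0)]
    exact le_top
  exact h f hf hf0 hft g hg hg0 hgt

theorem formBound_of_testing [SFinite σ] (hμ : AEMeasurable μ (σ.prod eta)) {p p' : ℝ}
    (hp : 2 ≤ p) (hpp' : p.HolderConjugate p')
    (hm : ∀ Q : DyadicCube n, mixedNorm p' σ (Q.box.indicator μ) < ∞)
    (hω : ∀ Q : DyadicCube n, ω Q.toSet < ∞) {T : ℝ≥0∞} (hT0 : T ≠ 0)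
    (hT : TestingBound σ ω μ lam p p' T) (hT' : DualTestingBound σ ω μ lam p p' T) :
    FormBound σ ω μ lam p p' ((halvesConst p p' + 2) * T) := by
  refine formBound_of_finite hμ hpp' (mul_ne_zero (by simp) hT0) fun f hf hf0 hft g hg hg0 hgt => ?_
  set a := mixedNorm p σ f
  set b := eLpNorm g (ENNReal.ofReal p') ω
  have ha : ((a⁻¹.toNNReal : ℝ≥0) : ℝ≥0∞) = a⁻¹ := ENNReal.coe_toNNReal (by simpa using hf0)
  have hb : ((b⁻¹.toNNReal : ℝ≥0) : ℝ≥0∞) = b⁻¹ := ENNReal.coe_toNNReal (by simpa using hg0)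
  have h1 := form_le_of_norm_le_one (lam := lam) hμ hp hpp' hm hω hT hT'
    (f := fun z => a⁻¹.toNNReal * f z) (hf.const_mul _)
    (by rw [mixedNorm_const_mul hpp'.pos, ha, ENNReal.inv_mul_cancel hf0 hft])
    (g := fun x => b⁻¹.toNNReal * g x) (hg.const_mul _)
    (by rw [eLpNorm_const_mul hpp'.symm.pos, hb, ENNReal.inv_mul_cancel hg0 hgt])
  rw [form_mul_mul, ha, hb] at h1
  calc form σ ω μ lam f g = (a * a⁻¹) * (b * b⁻¹) * form σ ω μ lam f g := by
        rw [ENNReal.mul_inv_cancel hf0 hft, ENNReal.mul_inv_cancel hg0 hgt, one_mul, one_mul]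
    _ = a * b * (a⁻¹ * b⁻¹ * form σ ω μ lam f g) := by ring
    _ ≤ a * b * (halvesConst p p' * T) := by gcongr
    _ ≤ a * b * ((halvesConst p p' + 2) * T) := by gcongr; exact le_self_add
    _ = (halvesConst p p' + 2) * T * a * b := by ring

theorem localForm_le_form (Q₀ : DyadicCube n) (f : HalfSpace n → ℝ≥0) (g : (Fin n → ℝ) → ℝ≥0) :
    localForm σ ω μ lam Q₀ f g ≤ form σ ω μ lam f g :=
  ENNReal.tsum_comp_le_tsum_of_injective Subtype.val_injective _

theorem FormBound.testingBound [SFinite σ] (hμ : AEMeasurable μ (σ.prod eta)) {p p' : ℝ} {K : ℝ≥0∞}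
    (h : FormBound σ ω μ lam p p' K) : TestingBound σ ω μ lam p p' K := fun Q g hg =>
  (localForm_le_form _ _ _).trans (h _ (aemeasurable_testFun hμ p' Q) g hg)

theorem FormBound.dualTestingBound {p p' : ℝ} {K : ℝ≥0∞} (h : FormBound σ ω μ lam p p' K) :
    DualTestingBound σ ω μ lam p p' K := fun Q f hf =>
  (localForm_le_form _ _ _).trans (h f hf _ (measurable_one.indicator Q.measurableSet_toSet))

theorem testingBound_of_lt {p p' : ℝ} {K : ℝ≥0∞} (h : testingConst σ ω μ lam p p' < K) :
    TestingBound σ ω μ lam p p' K := by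
  obtain ⟨C, hC, hCK⟩ := sInf_lt_iff.1 h
  exact fun Q g hg => (hC Q g hg).trans (by gcongr)

theorem dualTestingBound_of_lt {p p' : ℝ} {K : ℝ≥0∞} (h : dualTestingConst σ ω μ lam p p' < K) :
    DualTestingBound σ ω μ lam p p' K := by
  obtain ⟨C, hC, hCK⟩ := sInf_lt_iff.1 h
  exact fun Q f hf => (hC Q f hf).trans (by gcongr)

end FormBounds

/-! ### The operator -/

section Operator

variable {n : ℕ} {σ ω : Measure (Fin n → ℝ)} {μ : HalfSpace n → ℝ≥0} {lam : DyadicCube n → ℝ≥0}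

/-- The coefficient `λ_Q ∬_{Q̂} f μ` of the operator for non-negative `f`. -/
noncomputable def opCoeff (σ : Measure (Fin n → ℝ)) (μ : HalfSpace n → ℝ≥0)
    (lam : DyadicCube n → ℝ≥0) (f : HalfSpace n → ℝ≥0) (Q : DyadicCube n) : ℝ≥0∞ :=
  (lam Q : ℝ≥0∞) * ∫⁻ z in Q.box, (f z : ℝ≥0∞) * (μ z : ℝ≥0∞) ∂(σ.prod eta)

/-- The operator on non-negative functions, with values in `[0, ∞]`. -/
noncomputable def posOp (σ : Measure (Fin n → ℝ)) (μ : HalfSpace n → ℝ≥0)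
    (lam : DyadicCube n → ℝ≥0) (f : HalfSpace n → ℝ≥0) (x : Fin n → ℝ) : ℝ≥0∞ :=
  ∑' Q : DyadicCube n, Q.toSet.indicator (fun _ => opCoeff σ μ lam f Q) x

theorem measurable_posOp (f : HalfSpace n → ℝ≥0) : Measurable (posOp σ μ lam f) :=
  Measurable.tsum fun Q => measurable_const.indicator Q.measurableSet_toSet

theorem lintegral_indicator_mul (c : ℝ≥0∞) (Q : DyadicCube n) {g : (Fin n → ℝ) → ℝ≥0}
    (hg : Measurable g) : ∫⁻ x, Q.toSet.indicator (fun _ => c) x * (g x : ℝ≥0∞) ∂ω =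
      c * ∫⁻ x in Q.toSet, (g x : ℝ≥0∞) ∂ω := by
  rw [← lintegral_indicator Q.measurableSet_toSet, ← lintegral_const_mul _
    (hg.coe_nnreal_ennreal.indicator Q.measurableSet_toSet)]
  refine lintegral_congr fun x => ?_
  by_cases hx : x ∈ Q.toSet <;> simp [hx]

theorem form_eq_lintegral_posOp (f : HalfSpace n → ℝ≥0) {g : (Fin n → ℝ) → ℝ≥0}
    (hg : Measurable g) : form σ ω μ lam f g = ∫⁻ x, posOp σ μ lam f x * (g x : ℝ≥0∞) ∂ω := by
  have hm (Q : DyadicCube n) : Measurable fun x =>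
      Q.toSet.indicator (fun _ => opCoeff σ μ lam f Q) x * (g x : ℝ≥0∞) :=
    (measurable_const.indicator Q.measurableSet_toSet).mul hg.coe_nnreal_ennreal
  simp_rw [posOp, ← ENNReal.tsum_mul_right]
  rw [lintegral_tsum fun Q => (hm Q).aemeasurable]
  simp_rw [lintegral_indicator_mul _ _ hg]
  rfl

/-- Duality: the bound for the form gives the `L^p` bound for the operator. The partial sums are
bounded and live on sets of finite measure, so that their norms are finite. -/
theorem lintegral_posOp_rpow_le {p p' : ℝ} (hpp' : p.HolderConjugate p')
    (hω : ∀ Q : DyadicCube n, ω Q.toSet < ∞) {f : HalfSpace n → ℝ≥0}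
    (hfin : ∀ Q, opCoeff σ μ lam f Q ≠ ∞) {N : ℝ≥0∞}
    (h : ∀ g : (Fin n → ℝ) → ℝ≥0, Measurable g →
      form σ ω μ lam f g ≤ N * eLpNorm g (ENNReal.ofReal p') ω) :
    ∫⁻ x, posOp σ μ lam f x ^ p ∂ω ≤ N ^ p := by
  classical
  have hp := hpp'.pos
  have hp1 := hpp'.lt
  set c := opCoeff σ μ lam f with hc
  let u : Finset (DyadicCube n) → (Fin n → ℝ) → ℝ≥0 := fun s x =>
    ∑ Q ∈ s, Q.toSet.indicator (fun _ => (c Q).toNNReal) x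
  have hum (s) : Measurable (u s) :=
    Finset.measurable_fun_sum _ fun Q _ => measurable_const.indicator Q.measurableSet_toSet
  have hu (s) (x) : (u s x : ℝ≥0∞) = ∑ Q ∈ s, Q.toSet.indicator (fun _ => c Q) x := by
    simp only [u]
    push_cast
    refine Finset.sum_congr rfl fun Q _ => ?_
    by_cases hx : x ∈ Q.toSet <;> simp [hx, ENNReal.coe_toNNReal (hfin Q)]
  have hpart (s) : ∫⁻ x, (u s x : ℝ≥0∞) ^ p ∂ω ≤ N ^ p := by
    have hfinite : ∫⁻ x, (u s x : ℝ≥0∞) ^ p ∂ω ≠ ∞ := by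
      have hle : ∫⁻ x, (u s x : ℝ≥0∞) ^ p ∂ω ≤
          ∫⁻ x, ∑ Q ∈ s, Q.toSet.indicator (fun _ => (∑ Q ∈ s, c Q) ^ p) x ∂ω := by
        refine lintegral_mono fun x => ?_
        by_cases hex : ∃ Q ∈ s, x ∈ Q.toSet
        · obtain ⟨Q, hQ, hx⟩ := hex
          refine le_trans ?_ (Finset.single_le_sum (fun _ _ => zero_le) hQ)
          rw [Set.indicator_of_mem hx, hu]
          gcongr
          exact Set.indicator_le_self _ _ _
        · push Not at hex
          rw [hu, Finset.sum_eq_zero fun Q hQ => Set.indicator_of_notMem (hex Q hQ) _,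
            ENNReal.zero_rpow_of_pos hp]
          exact zero_le
      refine ne_top_of_le_ne_top ?_ hle
      rw [lintegral_finsetSum _ fun Q _ => measurable_const.indicator Q.measurableSet_toSet]
      refine ENNReal.sum_ne_top.2 fun Q _ => ?_
      rw [lintegral_indicator Q.measurableSet_toSet, lintegral_const,
        Measure.restrict_apply MeasurableSet.univ, Set.univ_inter]
      exact ENNReal.mul_ne_top (ENNReal.rpow_ne_top_of_nonneg hp.le
        (ENNReal.sum_ne_top.2 fun Q _ => hfin Q)) (hω Q).ne
    refine le_rpow_of_le_mul_rpow hpp' hfinite ?_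
    set g : (Fin n → ℝ) → ℝ≥0 := fun x => u s x ^ (p - 1) with hg
    have hgm : Measurable g := (hum s).pow_const _
    have hcoe (x) : (g x : ℝ≥0∞) = (u s x : ℝ≥0∞) ^ (p - 1) :=
      ENNReal.coe_rpow_of_nonneg _ (by linarith)
    calc ∫⁻ x, (u s x : ℝ≥0∞) ^ p ∂ω
        ≤ ∫⁻ x, posOp σ μ lam f x * (g x : ℝ≥0∞) ∂ω := by
          refine lintegral_mono fun x => ?_
          have h1 : (u s x : ℝ≥0∞) ≤ posOp σ μ lam f x := by
            rw [hu]
            exact ENNReal.sum_le_tsum s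
          have h2 : (u s x : ℝ≥0∞) ^ p = (u s x : ℝ≥0∞) * (g x : ℝ≥0∞) := by
            rw [hcoe]
            conv_rhs => rw [← ENNReal.rpow_one (u s x : ℝ≥0∞), ← ENNReal.rpow_mul, one_mul]
            rw [← ENNReal.rpow_add_of_nonneg _ _ zero_le_one (by linarith)]
            congr 1
            ring
          rw [h2]
          gcongr
      _ = form σ ω μ lam f g := (form_eq_lintegral_posOp f hgm).symm
      _ ≤ N * eLpNorm g (ENNReal.ofReal p') ω := h g hgm
      _ = N * (∫⁻ x, (u s x : ℝ≥0∞) ^ p ∂ω) ^ (1 / p') := by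
          rw [eLpNorm_eq hpp'.symm.pos]
          simp_rw [enorm_NNReal, hcoe, ← ENNReal.rpow_mul, hpp'.sub_one_mul_conj]
  have hsup (x) : posOp σ μ lam f x ^ p = ⨆ s, (u s x : ℝ≥0∞) ^ p := by
    simp_rw [posOp, ENNReal.tsum_eq_iSup_sum, hu]
    exact (ENNReal.orderIsoRpow p hp).map_iSup _
  simp_rw [hsup]
  rw [lintegral_iSup_directed (fun s => ((hum s).coe_nnreal_ennreal.pow_const p).aemeasurable)]
  · exact iSup_le hpart
  · refine Monotone.directed_le fun s t hst x => ?_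
    refine ENNReal.rpow_le_rpow (ENNReal.coe_le_coe.2 ?_) hp.le
    exact Finset.sum_le_sum_of_subset hst

theorem opCoeff_ne_top [SFinite σ] (hμ : AEMeasurable μ (σ.prod eta)) {p p' : ℝ}
    (hpp' : p.HolderConjugate p')
    (hm : ∀ Q : DyadicCube n, mixedNorm p' σ (Q.box.indicator μ) < ∞)
    {f : HalfSpace n → ℝ≥0} (hf : AEMeasurable f (σ.prod eta)) (hfn : mixedNorm p σ f ≠ ∞)
    (Q : DyadicCube n) : opCoeff σ μ lam f Q ≠ ∞ :=
  ENNReal.mul_ne_top ENNReal.coe_ne_top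
    (setLIntegral_box_lt_top hμ hpp' hf hfn (hm Q).ne).ne

theorem FormBound.opBounded [SFinite σ] (hμ : AEMeasurable μ (σ.prod eta)) {p p' : ℝ}
    (hpp' : p.HolderConjugate p')
    (hm : ∀ Q : DyadicCube n, mixedNorm p' σ (Q.box.indicator μ) < ∞)
    (hω : ∀ Q : DyadicCube n, ω Q.toSet < ∞) {K : ℝ≥0} (h : FormBound σ ω μ lam p p' K) :
    OpBounded σ ω μ lam p := by
  refine ⟨K, fun f hf hfn => ?_⟩
  have hp := hpp'.pos
  let f₀ : HalfSpace n → ℝ≥0 := fun z => ‖f z‖₊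
  have hf₀ : AEMeasurable f₀ (σ.prod eta) := hf.nnnorm
  have hnorm : mixedNorm p σ f₀ = mixedNorm p σ f := rfl
  have hfin := opCoeff_ne_top (lam := lam) hμ hpp' hm hf₀ (hnorm ▸ hfn.ne)
  have henorm (z) : ‖f z * ((μ z : ℝ) : ℂ)‖ₑ = (f₀ z : ℝ≥0∞) * (μ z : ℝ≥0∞) := by
    rw [enorm_mul]
    congr 1
    simp [enorm_eq_nnnorm]
  have hterm (x) (Q) : ‖opTerm σ μ lam f x Q‖ₑ ≤
      Q.toSet.indicator (fun _ => opCoeff σ μ lam f₀ Q) x := by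
    by_cases hx : x ∈ Q.toSet
    · rw [opTerm, Set.indicator_of_mem hx, Set.indicator_of_mem hx, enorm_mul, opCoeff]
      gcongr
      · simp [enorm_eq_nnnorm]
      · exact (enorm_integral_le_lintegral_enorm _).trans_eq (lintegral_congr henorm)
    · simp [opTerm, hx]
  have hsum (x) : ∑' Q, ‖opTerm σ μ lam f x Q‖ₑ ≤ posOp σ μ lam f₀ x :=
    ENNReal.tsum_le_tsum (hterm x)
  have hbound := lintegral_posOp_rpow_le hpp' hω hfin fun g hg => h f₀ hf₀ g hg
  refine ⟨fun Q => ⟨?_, ?_⟩, ?_, ?_⟩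
  · have hμc : AEMeasurable (fun z => ((μ z : ℝ) : ℂ)) (σ.prod eta) :=
      Complex.measurable_ofReal.comp_aemeasurable hμ.coe_nnreal_real
    exact ((hf.mul hμc).restrict).aestronglyMeasurable
  · rw [hasFiniteIntegral_iff_enorm, lintegral_congr henorm]
    exact setLIntegral_box_lt_top hμ hpp' hf₀ (hnorm ▸ hfn.ne) (hm Q).ne
  · have hlt : ∫⁻ x, posOp σ μ lam f₀ x ^ p ∂ω ≠ ∞ := by
      refine ne_top_of_le_ne_top (ENNReal.rpow_ne_top_of_nonneg hp.le ?_) hbound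
      exact ENNReal.mul_ne_top ENNReal.coe_ne_top (hnorm ▸ hfn.ne)
    filter_upwards [ae_lt_top ((measurable_posOp f₀).pow_const p) hlt] with x hx
    refine Summable.of_enorm (ne_top_of_le_ne_top (fun htop => ?_) (hsum x))
    simp [htop, hp] at hx
  · rw [eLpNorm_eq hp, ← hnorm]
    calc (∫⁻ x, ‖op σ μ lam f x‖ₑ ^ p ∂ω) ^ (1 / p)
        ≤ (∫⁻ x, posOp σ μ lam f₀ x ^ p ∂ω) ^ (1 / p) := by
          gcongr with x
          exact enorm_tsum_le_tsum_enorm.trans (hsum x)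
      _ ≤ ((K * mixedNorm p σ f₀) ^ p) ^ (1 / p) := by gcongr
      _ = K * mixedNorm p σ f₀ := by
          rw [← ENNReal.rpow_mul, mul_one_div_cancel hp.ne', ENNReal.rpow_one]

theorem OpBounded.exists_formBound [SFinite σ] (hμ : AEMeasurable μ (σ.prod eta)) {p p' : ℝ}
    (hpp' : p.HolderConjugate p')
    (hm : ∀ Q : DyadicCube n, mixedNorm p' σ (Q.box.indicator μ) < ∞)
    (h : OpBounded σ ω μ lam p) : ∃ K : ℝ≥0, FormBound σ ω μ lam p p' K := by
  obtain ⟨C, hC⟩ := h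
  have hp := hpp'.pos
  refine ⟨C + 1, formBound_of_finite hμ hpp' (by simp) fun f hf _ hft g hg _ _ => ?_⟩
  let f₁ : HalfSpace n → ℂ := fun z => ((f z : ℝ) : ℂ)
  have hf₁ : AEMeasurable f₁ (σ.prod eta) :=
    Complex.measurable_ofReal.comp_aemeasurable hf.coe_nnreal_real
  have henorm (z) : ‖f₁ z‖ₑ = ‖f z‖ₑ := by simp [f₁, enorm_eq_nnnorm]
  have hnorm : mixedNorm p σ f₁ = mixedNorm p σ f := by
    simp only [mixedNorm_eq hp, ell2Norm, henorm]
  obtain ⟨-, hsum, hop⟩ := hC f₁ hf₁ (hnorm ▸ hft.lt_top)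
  have hfin := opCoeff_ne_top (lam := lam) hμ hpp' hm hf hft
  -- on a non-negative function the terms of the operator are the coefficients of `posOp`
  have hterm (x) (Q) : opTerm σ μ lam f₁ x Q =
      ((Q.toSet.indicator (fun _ => opCoeff σ μ lam f Q) x).toReal : ℂ) := by
    by_cases hx : x ∈ Q.toSet
    · have hint : ∫ z in Q.box, f₁ z * ((μ z : ℝ) : ℂ) ∂(σ.prod eta) =
          ((∫⁻ z in Q.box, (f z : ℝ≥0∞) * (μ z : ℝ≥0∞) ∂(σ.prod eta)).toReal : ℂ) := by
        rw [← integral_toReal]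
        · rw [← integral_complex_ofReal]
          simp [f₁]
        · exact (hf.coe_nnreal_ennreal.mul hμ.coe_nnreal_ennreal).restrict
        · exact Filter.Eventually.of_forall fun z => by simp [← ENNReal.coe_mul]
      simp only [opTerm, Set.indicator_of_mem hx]
      rw [hint, opCoeff, ENNReal.toReal_mul]
      simp
    · simp [opTerm, hx]
  have hae : ∀ᵐ x ∂ω, ‖op σ μ lam f₁ x‖ₑ = posOp σ μ lam f x := by
    filter_upwards [hsum] with x hx
    have hne (Q : DyadicCube n) : Q.toSet.indicator (fun _ => opCoeff σ μ lam f Q) x ≠ ∞ := by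
      by_cases hxQ : x ∈ Q.toSet <;> simp [hxQ, hfin]
    simp only [funext (hterm x)] at hx
    have hx' := Complex.summable_ofReal.1 hx
    have hnn : 0 ≤ ∑' Q : DyadicCube n,
        (Q.toSet.indicator (fun _ => opCoeff σ μ lam f Q) x).toReal :=
      tsum_nonneg fun _ => ENNReal.toReal_nonneg
    simp only [op, hterm]
    rw [← Complex.ofReal_tsum, ← ofReal_norm, Complex.norm_of_nonneg hnn,
      ENNReal.ofReal_tsum_of_nonneg (fun _ => ENNReal.toReal_nonneg) hx', posOp]
    exact tsum_congr fun Q => ENNReal.ofReal_toReal (hne Q)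
  rw [form_eq_lintegral_posOp f hg]
  calc ∫⁻ x, posOp σ μ lam f x * (g x : ℝ≥0∞) ∂ω
      ≤ (∫⁻ x, posOp σ μ lam f x ^ p ∂ω) ^ (1 / p) * (∫⁻ x, (g x : ℝ≥0∞) ^ p' ∂ω) ^ (1 / p') :=
        ENNReal.lintegral_mul_le_Lp_mul_Lq ω hpp' (measurable_posOp f).aemeasurable
          hg.coe_nnreal_ennreal.aemeasurable
    _ = eLpNorm (op σ μ lam f₁) (ENNReal.ofReal p) ω * eLpNorm g (ENNReal.ofReal p') ω := by
        rw [eLpNorm_eq hp, eLpNorm_eq hpp'.symm.pos]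
        congr 2
        exact lintegral_congr_ae (hae.mono fun x hx => by simp only [hx])
    _ ≤ C * mixedNorm p σ f * eLpNorm g (ENNReal.ofReal p') ω := by
        rw [← hnorm]
        gcongr
    _ ≤ _ := by
        gcongr
        exact le_self_add

end Operator

end MixedDyadic

theorem theorem1p1 (p p' : ℝ) (hp : 2 ≤ p) (hpp' : p.HolderConjugate p') :
    ∃ C : ℝ≥0, ∀ (n : ℕ), 0 < n →
      ∀ (σ ω : Measure (Fin n → ℝ)) [IsLocallyFiniteMeasure σ] [IsLocallyFiniteMeasure ω]
        (μ : HalfSpace n → ℝ≥0) (lam : DyadicCube n → ℝ≥0),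
        AEMeasurable μ (σ.prod eta) →
        (∀ Q : DyadicCube n, mixedNorm p' σ (Q.box.indicator μ) < ∞) →
          ((∃ K : ℝ≥0, FormBound σ ω μ lam p p' K) ↔
            testingConst σ ω μ lam p p' + dualTestingConst σ ω μ lam p p' < ∞) ∧
          ((∃ K : ℝ≥0, FormBound σ ω μ lam p p' K) ↔ OpBounded σ ω μ lam p) ∧
          (testingConst σ ω μ lam p p' + dualTestingConst σ ω μ lam p p' < ∞ →
            formNorm σ ω μ lam p p' ≤
                C * (testingConst σ ω μ lam p p' + dualTestingConst σ ω μ lam p p') ∧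
              testingConst σ ω μ lam p p' + dualTestingConst σ ω μ lam p p' ≤
                C * formNorm σ ω μ lam p p') := by
  have hconst : halvesConst p p' + 2 ≠ ∞ :=
    ENNReal.add_ne_top.2 ⟨(halvesConst_lt_top hpp').ne, by simp⟩
  refine ⟨(halvesConst p p' + 2).toNNReal, fun n _ σ ω _ _ μ lam hμ hm => ?_⟩
  rw [ENNReal.coe_toNNReal hconst]
  have hω := DyadicCube.measure_toSet_lt_top ω
  set t := testingConst σ ω μ lam p p' + dualTestingConst σ ω μ lam p p' with ht
  have hupper : ∀ K, t < K → FormBound σ ω μ lam p p' ((halvesConst p p' + 2) * K) := fun K hK =>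
    formBound_of_testing hμ hp hpp' hm hω (zero_le.trans_lt hK).ne'
      (testingBound_of_lt (le_self_add.trans_lt hK))
      (dualTestingBound_of_lt (le_add_self.trans_lt hK))
  have hlower : ∀ K, FormBound σ ω μ lam p p' K → t ≤ 2 * K := fun K hK => by
    rw [two_mul]
    exact add_le_add (sInf_le (hK.testingBound hμ)) (sInf_le hK.dualTestingBound)
  refine ⟨⟨?_, fun hlt => ?_⟩, ⟨?_, fun h => h.exists_formBound hμ hpp' hm⟩, fun _ => ⟨?_, ?_⟩⟩
  · rintro ⟨K, hK⟩
    exact (hlower K hK).trans_lt (ENNReal.mul_lt_top (by simp) ENNReal.coe_lt_top)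
  · refine ⟨((halvesConst p p' + 2) * (t + 1)).toNNReal, ?_⟩
    rw [ENNReal.coe_toNNReal (ENNReal.mul_ne_top hconst (by simp [hlt.ne]))]
    exact hupper _ (ENNReal.lt_add_right hlt.ne one_ne_zero)
  · rintro ⟨K, hK⟩
    exact hK.opBounded hμ hpp' hm hω
  · have h0 : halvesConst p p' + 2 ≠ 0 := by simp
    rw [mul_comm, ← ENNReal.div_le_iff h0 hconst]
    refine le_of_forall_gt_imp_ge_of_dense fun K hK => ?_
    rw [ENNReal.div_le_iff h0 hconst, mul_comm]
    exact sInf_le (hupper K hK)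
  · have h2 : t ≤ 2 * formNorm σ ω μ lam p p' := by
      rw [mul_comm, ← ENNReal.div_le_iff (by simp) (by simp)]
      refine le_sInf fun K hK => ?_
      rw [ENNReal.div_le_iff (by simp) (by simp), mul_comm]
      exact hlower K hK
    exact h2.trans (by gcongr; exact le_add_self)
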